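/- Let $D\ge 0$, $N\ge 1$, $T\ge 1$ be integers and $\mathcal X=\mathbb R^D$. Quantities with time subscript $0$ are ignored, so that functions of $(x_0,x_1)$ are functions of $x_1$ only. Write $\mathrm N(\cdot\,;\mu,\Sigma)$ for the Gaussian law, or its Lebesgue density. For $t=1,\dots,T$ let - $M_t(x_t\mid x_{t-1})=\mathrm N(x_t;m_t(x_{t-1}),C_t)$, where $m_t\colon\mathcal X\to\mathcal X$ is measurable and the symmetric positive definite matrix $C_t$ does not depend on $x_{t-1}$; - $G_t(x_{t-1},x_t)>0$ be jointly measurable, and differentiable in $x_t$; - $\tilde C_t(x_{t-1})\in\mathbb R^{D\times D}$ be an arbitrary measurable matrix-valued function (the preconditioner); - $\delta_t>0$, $\beta_t=\frac{2}{2+\delta_t}$, and let $\kappa\in\{0,1\}$. Put $Q_t(x_{t-1},x_t)=M_t(x_t\mid x_{t-1})G_t(x_{t-1},x_t)$ and assume $\int_{\mathcal X^T}\prod_{t=1}^TQ_t(x_{t-1},x_t)\,dx_{1:T}<\infty$. Let $\pi_T$ be the probability distribution on $\mathcal X^T$ with density proportional to $\prod_{t=1}^TQ_t(x_{t-1},x_t)$.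 Put $$\phi_t(x',x)=\kappa\tfrac{\delta_t}{2}\tilde C_t(x')\nabla_x\log G_t(x',x),\qquad v_t(x')=(1-\beta_t)m_t(x'),\qquad \Gamma_t=\frac{\beta_t}{(1-\beta_t)(1+N\beta_t)}C_t^{-1},$$ $$\begin{aligned}\log H_{t,\phi}(x,v,\bar x,\bar v)={}&\tfrac12(\beta_t^{-1}+N+1)(x-v)^{\mathsf T}\Gamma_t(x-v)-\tfrac12N\beta_t(x+\phi)^{\mathsf T}\Gamma_t(x+\phi)\\&+(N+1)(\bar x-\bar v)^{\mathsf T}\Gamma_t(v+\phi)-(x-v)^{\mathsf T}\Gamma_t(x+\phi).\end{aligned}$$ One iteration of the Particle-PCNL algorithm, given $x_{1:T}\in\mathcal X^T$, is as follows. 1. For $t=1,\dots,T$: (a) draw $k_t$ uniformly from $\{0,\dots,N\}$ and set $x_t^{k_t}=x_t$; (b) if $t>1$, set $a_{t-1}^{k_t}=k_{t-1}$ and, for $n\ne k_t$, draw $a_{t-1}^n=i$ with probability $W_{t-1}^i$; (c) draw $u_t\sim \mathrm N(x_t+\phi_t(x_{t-1},x_t),\frac{\delta_t}{2}C_t)$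 and, independently for $n\neq k_t$ given $u_t$, $x_t^n\sim \mathrm N(\beta_tu_t+(1-\beta_t)m_t(x_{t-1}^{a_{t-1}^n}),(1-\beta_t)C_t)$; (d) put $x_{t-1}^{(n)}=x_{t-1}^{a_{t-1}^n}$, $v_t^n=v_t(x_{t-1}^{(n)})$, $\phi_t^n=\phi_t(x_{t-1}^{(n)},x_t^n)$, $\bar x_t=\frac1{N+1}\sum_nx_t^n$, $\bar v_t=\frac1{N+1}\sum_nv_t^n$, and $$w_t^n=Q_t(x_{t-1}^{(n)},x_t^n)\,H_{t,\phi_t^n}(x_t^n,v_t^n,\bar x_t,\bar v_t),\qquad W_t^n=w_t^n\Big/\sum_{j=0}^Nw_t^j .$$ 2. Draw $i\neq k_T$ with probability $W_T^i/(1-W_T^{k_T})$; set $l_T=i$ with probability $1\wedge\frac{1-W_T^{k_T}}{1-W_T^i}$, and $l_T=k_T$ otherwise. 3. For $t=T-1,\dots,1$, draw $l_t=i$ with probability proportional to $W_t^iQ_{t+1}(x_t^i,x_{t+1}^{l_{t+1}})$. 4. Return $x'_{1:T}=(x_1^{l_1},\dots,x_T^{l_T})$. **Proposition.** Sampling $x'_{1:T}$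 given $x_{1:T}$ in this way induces a Markov kernel on $\mathcal X^T$ which leaves $\pi_T$ invariant. Moreover, this kernel is the special case $H_t=\beta_tI$, $D_t=(1-\beta_t)C_t$, $E_t=\frac{\delta_t}{2}C_t$ of the generic marginal algorithm. The latter, for given $\phi_t$, $v_t$, $H_t$, $D_t$, $E_t$, is the algorithm above with step (c) replaced by $u_t\sim\mathrm N(x_t+\phi_t(x_{t-1},x_t),E_t)$, $x_t^n\sim\mathrm N(v_t(x_{t-1}^{(n)})+H_tu_t,D_t)$ independently for $n\ne k_t$ given $u_t$, and with the weights in (d) replaced by $w_t^n=Q_t(x_{t-1}^{(n)},x_t^n)\,q_t^{-n}$, where the auxiliary variable is marginalised out: $$q_t^{-n}=\int_{\mathcal X}\mathrm N(u;x_t^n+\phi_t^n,E_t)\prod_{j\neq n}\mathrm N(x_t^j;v_t^j+H_tu,D_t)\,du .$$ That is, for every $x_{1:T}$ the two algorithms have the same output law. -/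

import Mathlib

open MeasureTheory ProbabilityTheory

namespace ParticlePCNL

/-- The state space `ℝ^D`, with its Euclidean structure. -/
abbrev State (D : ℕ) := EuclideanSpace ℝ (Fin D)

/-- A system of `N + 1` particles, indexed by `0, …, N`. -/
abbrev Particles (D N : ℕ) := Fin (N + 1) → State D

/-- The bilinear form `xᵀ A y`. -/
def bilin {D : ℕ} (A : Matrix (Fin D) (Fin D) ℝ) (x y : State D) : ℝ :=
  x.ofLp ⬝ᵥ (A.mulVec y.ofLp)

/-- The density `N(x; μ, Σ)` of the Gaussian law with mean `μ` and positive definite covariance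
matrix `Σ`, with respect to the Lebesgue measure. -/
noncomputable def gaussianDensity {D : ℕ} (μ : State D) (Sig : Matrix (Fin D) (Fin D) ℝ)
    (x : State D) : ℝ :=
  (Real.sqrt ((2 * Real.pi) ^ D * Sig.det))⁻¹ * Real.exp (-(1 / 2) * bilin Sig⁻¹ (x - μ) (x - μ))

/-! ### Feynman–Kac models with conditionally Gaussian mutation kernels -/

/-- The data of a Feynman–Kac model on `ℝ^D` with Gaussian mutation kernels
`M_t(x_t | x_{t-1}) = N(x_t; m_t(x_{t-1}), C_t)` and potential functions `G_t(x_{t-1}, x_t)`,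
for times `t = 1, 2, …`.

There is no state at time `0`. The quantities at time `1` depend on `x_1` only; they are obtained
by giving `x_0` the fixed dummy value `0`, that is, `M_1(x_1) = N(x_1; m 1 0, C 1)` and
`G_1(x_1) = G 1 0 x_1`. -/
structure Model (D : ℕ) where
  /-- the conditional means `m_t(x_{t-1})` -/
  m : ℕ → State D → State D
  /-- the covariance matrices `C_t`, which do not depend on the previous state -/
  C : ℕ → Matrix (Fin D) (Fin D) ℝ
  /-- the potential functions `G_t(x_{t-1}, x_t)` -/
  G : ℕ → State D → State D → ℝ

namespace Model

variable {D : ℕ} (F : Model D)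

/-- The density of the mutation kernel, `M_t(x_t | x_{t-1})`, as a function of `x_{t-1}`, `x_t`. -/
noncomputable def M (t : ℕ) (x' x : State D) : ℝ :=
  gaussianDensity (F.m t x') (F.C t) x

/-- `Q_t(x_{t-1}, x_t) = M_t(x_t | x_{t-1}) G_t(x_{t-1}, x_t)`. -/
noncomputable def Q (t : ℕ) (x' x : State D) : ℝ :=
  F.M t x' x * F.G t x' x

/-- `∏_{t=1}^T Q_t(x_{t-1}, x_t)` for the time horizon `T = S + 1`. The path `x_{1:T}` is indexed
by `Fin (S + 1)`, so that `x i` is the state at time `i + 1`; `Fin.cons 0 x` is `x_{0:T}`. -/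
noncomputable def pathWeight (S : ℕ) (x : Fin (S + 1) → State D) : ℝ :=
  ∏ i : Fin (S + 1),
    F.Q (i + 1) ((Fin.cons 0 x : Fin (S + 2) → State D) i.castSucc) (x i)

/-- The measure on paths with Lebesgue density `∏_{t=1}^T Q_t(x_{t-1}, x_t)`, `T = S + 1`. -/
noncomputable def unnormalizedTarget (S : ℕ) : Measure (Fin (S + 1) → State D) :=
  volume.withDensity fun x => ENNReal.ofReal (F.pathWeight S x)

/-- The joint smoothing distribution `π_T(x_{1:T}) ∝ ∏_{t=1}^T Q_t(x_{t-1}, x_t)`, `T = S + 1`. -/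
noncomputable def target (S : ℕ) : Measure (Fin (S + 1) → State D) :=
  (F.unnormalizedTarget S Set.univ)⁻¹ • F.unnormalizedTarget S

end Model

/-! ### Conditional sequential Monte Carlo with forced move and backward sampling -/

/-- The normalised weights `w^n / ∑_m w^m`. -/
noncomputable def normalize {N : ℕ} (w : Fin (N + 1) → ℝ) (n : Fin (N + 1)) : ℝ :=
  w n / ∑ l, w l

/-- The law on `{0, …, N}` that gives mass `p i` to `i`. -/
noncomputable def categorical {N : ℕ} (p : Fin (N + 1) → ℝ) : Measure (Fin (N + 1)) :=
  ∑ i, ENNReal.ofReal (p i) • Measure.dirac i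

/-- The uniform law on `{0, …, N}`. -/
noncomputable def uniformIndex (N : ℕ) : Measure (Fin (N + 1)) :=
  categorical fun _ => 1 / ((N : ℝ) + 1)

/-- The part of the particle system at time `t` that later steps of the algorithm use:
the index `k_t` of the reference particle, the particles `x_t^0, …, x_t^N` and their normalised
weights `W_t^0, …, W_t^N`. -/
abbrev Slice (D N : ℕ) := Fin (N + 1) × Particles D N × (Fin (N + 1) → ℝ)

/-- What distinguishes one conditional sequential Monte Carlo algorithm from another.
The argument `prev` stands for the parents `(x_{t-1}^{a_{t-1}^n})_{n = 0, …, N}` of the particles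
at time `t`. -/
structure Scheme (D N : ℕ) where
  /-- the functions `Q_t(x_{t-1}, x_t)` used in the backward sampling step -/
  Q : ℕ → State D → State D → ℝ
  /-- `propose t prev k x`: the law of `(x_t^0, …, x_t^N)` when the reference particle has index
  `k` and value `x` -/
  propose : ℕ → Particles D N → Fin (N + 1) → State D → Measure (Particles D N)
  /-- `weight t prev z n`: the unnormalised weight of the particle `n`, when the particles at
  time `t` are `z` -/
  weight : ℕ → Particles D N → Particles D N → Fin (N + 1) → ℝ

/-- The law of the ancestor indices `a^0, …, a^N`: the reference particle, with index `k`, has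
ancestor `k'`, and the other ancestors are drawn independently according to the weights `W`. -/
noncomputable def ancestors {N : ℕ} (W : Fin (N + 1) → ℝ) (k' k : Fin (N + 1)) :
    Measure (Fin (N + 1) → Fin (N + 1)) :=
  Measure.pi fun n => if n = k then Measure.dirac k' else categorical W

/-- The forced move for the final index: draw `i ≠ k` with probability `W^i / (1 - W^k)`; return
`i` with probability `1 ∧ (1 - W^k) / (1 - W^i)`, and otherwise return `k`. -/
noncomputable def forcedMove {N : ℕ} (k : Fin (N + 1)) (W : Fin (N + 1) → ℝ) :
    Measure (Fin (N + 1)) :=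
  ∑ i ∈ Finset.univ.erase k, ENNReal.ofReal (W i / (1 - W k)) •
    (ENNReal.ofReal (min 1 ((1 - W k) / (1 - W i))) • Measure.dirac i +
      ENNReal.ofReal (1 - min 1 ((1 - W k) / (1 - W i))) • Measure.dirac k)

namespace Scheme

variable {D N : ℕ} (A : Scheme D N)

/-- Propose the particles at time `t`, given their parents, and compute the normalised weights. -/
noncomputable def populate (t : ℕ) (prev : Particles D N) (k : Fin (N + 1)) (x : State D) :
    Measure (Slice D N) :=
  (A.propose t prev k x).map fun z => (k, z, normalize (A.weight t prev z))

/-- The law of the particle system at time `1`, when the reference path starts in `x`. -/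
noncomputable def initial (x : State D) : Measure (Slice D N) :=
  (uniformIndex N).bind fun k => A.populate 1 (fun _ => 0) k x

/-- The law of the particle system at time `t + 1` given the one at time `t`, when the reference
path is in `x` at time `t + 1`. -/
noncomputable def step (t : ℕ) (s : Slice D N) (x : State D) : Measure (Slice D N) :=
  (uniformIndex N).bind fun k =>
    (ancestors s.2.2 s.1 k).bind fun a =>
      A.populate (t + 1) (fun n => s.2.1 (a n)) k x

/-- Backward sampling of the index `l_t`, given the particle system at time `t` and the selected
state `x = x_{t+1}^{l_{t+1}}` at time `t + 1`. -/
noncomputable def backward (t : ℕ) (s : Slice D N) (x : State D) : Measure (Fin (N + 1)) :=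
  categorical (normalize fun i => s.2.2 i * A.Q (t + 1) (s.2.1 i) x)

/-- `run r t s x` is the law of the output `(x_t^{l_t}, …, x_{t+r}^{l_{t+r}})` of the algorithm
with final time `t + r`, given the particle system `s` at time `t` and the reference states `x` at
the times `t + 1, …, t + r`. First the particle systems at the times `t + 1, …, t + r` are
generated, then the final index is drawn by the forced move, then the indices
`l_{t+r-1}, …, l_t` are drawn in this order by backward sampling. -/
noncomputable def run : (r : ℕ) → ℕ → Slice D N → (Fin r → State D) →
    Measure (Fin (r + 1) → State D)
  | 0, _, s, _ => (forcedMove s.1 s.2.2).map fun l => fun _ => s.2.1 l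
  | r + 1, t, s, x =>
      (A.step t s (x 0)).bind fun s' =>
        (run r (t + 1) s' (Fin.tail x)).bind fun y =>
          (A.backward t s (y 0)).map fun l => (Fin.cons (s.2.1 l) y : Fin (r + 2) → State D)

/-- The law of the output of one iteration of the algorithm with time horizon `T = S + 1`, given
the reference path `x = x_{1:T}`. -/
noncomputable def law (S : ℕ) (x : Fin (S + 1) → State D) : Measure (Fin (S + 1) → State D) :=
  (A.initial (x 0)).bind fun s => A.run S 1 s (Fin.tail x)

end Scheme

/-! ### The generic marginal algorithm -/

/-- The marginal density `q_t^{-n}(x_t^{-n} | x_t^n)` of the particles other than `n`, obtained by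
integrating the auxiliary variable `u` out of
`N(u; x^n + φ_n, E) ∏_{l ≠ n} N(x^l; v_l + H u, R)`. Here `z` stands for `(x^0, …, x^N)`. -/
noncomputable def marginalProposal {D N : ℕ} (phi v : Fin (N + 1) → State D)
    (H R E : Matrix (Fin D) (Fin D) ℝ) (z : Particles D N) (n : Fin (N + 1)) : ℝ :=
  ∫ u : State D, gaussianDensity (z n + phi n) E u *
    ∏ l ∈ Finset.univ.erase n, gaussianDensity (v l + Matrix.toEuclideanLin H u) R (z l)

/-- The generic marginal algorithm with drift `φ_t(x_{t-1}, x_t)`, mutation kernels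
`N(x_t; v_t(x_{t-1}) + H_t u_t, R_t)`, auxiliary covariances `E_t`, and weights
`w_t^n ∝ Q_t(x_{t-1}^{a_{t-1}^n}, x_t^n) q_t^{-n}(x_t^{-n} | x_t^n)`. -/
noncomputable def genericMarginal {D : ℕ} (N : ℕ) (Q : ℕ → State D → State D → ℝ)
    (phi : ℕ → State D → State D → State D) (v : ℕ → State D → State D)
    (H R E : ℕ → Matrix (Fin D) (Fin D) ℝ) : Scheme D N where
  Q := Q
  propose t prev k x :=
    (multivariateGaussian (x + phi t (prev k) x) (E t)).bind fun u =>
      Measure.pi fun n => if n = k then Measure.dirac x else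
        multivariateGaussian (v t (prev n) + Matrix.toEuclideanLin (H t) u) (R t)
  weight t prev z n := Q t (prev n) (z n) *
    marginalProposal (fun l => phi t (prev l) (z l)) (fun l => v t (prev l)) (H t) (R t) (E t) z n

/-! ### The Particle-PCNL algorithm -/

/-- `β = 2 / (2 + δ)`. -/
noncomputable def beta (δ : ℝ) : ℝ := 2 / (2 + δ)

namespace Model

variable {D : ℕ} (F : Model D) (N : ℕ) (δ : ℕ → ℝ) (κ : ℝ)
  (Cpre : ℕ → State D → Matrix (Fin D) (Fin D) ℝ)

/-- The drift `φ_t(x_{t-1}, x_t) = κ (δ_t / 2) C̃_t(x_{t-1}) ∇_{x_t} log G_t(x_{t-1}, x_t)`, where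
`Cpre` stands for the preconditioning matrices `C̃_t`. -/
noncomputable def drift (t : ℕ) (x' x : State D) : State D :=
  (κ * (δ t / 2)) •
    Matrix.toEuclideanLin (Cpre t x') (gradient (fun y => Real.log (F.G t x' y)) x)

/-- `v_t(x_{t-1}) = (1 - β_t) m_t(x_{t-1})`. -/
noncomputable def offset (t : ℕ) (x' : State D) : State D :=
  (1 - beta (δ t)) • F.m t x'

/-- The matrix `β_t / ((1 - β_t) (1 + N β_t)) C_t⁻¹`. -/
noncomputable def gainMatrix (t : ℕ) : Matrix (Fin D) (Fin D) ℝ :=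
  (beta (δ t) / ((1 - beta (δ t)) * (1 + N * beta (δ t)))) • (F.C t)⁻¹

/-- The logarithm of the weight factor `H_{t,φ}(x, v, x̄, v̄)`. -/
noncomputable def logWeightFactor (t : ℕ) (phi x v xbar vbar : State D) : ℝ :=
  1 / 2 * ((beta (δ t))⁻¹ + N + 1) * bilin (F.gainMatrix N δ t) (x - v) (x - v)
    - 1 / 2 * N * beta (δ t) * bilin (F.gainMatrix N δ t) (x + phi) (x + phi)
    + (N + 1) * bilin (F.gainMatrix N δ t) (xbar - vbar) (v + phi)
    - bilin (F.gainMatrix N δ t) (x - v) (x + phi)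

/-- The Particle-PCNL algorithm. Given the parents `prev` and the reference particle `x` with
index `k` (whose parent `prev k` is the reference state at time `t - 1`), draw
`u ~ N(x + φ_t(prev k, x), (δ_t / 2) C_t)` and then, independently for `n ≠ k`,
`x_t^n ~ N(β_t u + (1 - β_t) m_t(prev n), (1 - β_t) C_t)`. -/
noncomputable def pcnl : Scheme D N where
  Q := F.Q
  propose t prev k x :=
    (multivariateGaussian (x + F.drift δ κ Cpre t (prev k) x) ((δ t / 2) • F.C t)).bind fun u =>
      Measure.pi fun n => if n = k then Measure.dirac x else
        multivariateGaussian (beta (δ t) • u + (1 - beta (δ t)) • F.m t (prev n))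
          ((1 - beta (δ t)) • F.C t)
  weight t prev z n := F.Q t (prev n) (z n) *
    Real.exp (F.logWeightFactor N δ t (F.drift δ κ Cpre t (prev n) (z n)) (z n)
      (F.offset δ t (prev n))
      (((N : ℝ) + 1)⁻¹ • ∑ l, z l)
      (((N : ℝ) + 1)⁻¹ • ∑ l, F.offset δ t (prev l)))

end Model

end ParticlePCNL

namespace ParticlePCNL

/-! ### Products of measures with densities -/

/-! The proof has two halves: both algorithms have the same output law, and the generic marginal
algorithm leaves the target invariant.

Equality of laws. With the PCNL choices every covariance is a scalar multiple of `C_t`, and the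
integrand of `marginalProposal` is the exponential of a quadratic in `u`. Completing the square
(`complete_square`) splits off a Gaussian density in `u`, of mass one. What remains is
`commonFactor`, the same for every `n`, times the exponential of `logWeightFactor`
(`marginalProposal_eq`). Normalising the weights removes the common factor, and the algorithm sees
the weights only after normalisation.

Invariance. Fix the parents and let the reference state `x` have density `Q_t` given its own parent.
Since `w^k` is `Q_t` times the density of the other particles given the reference one, the joint
measure of `x` and the particles `z` has density `w^k(z)` with respect to Lebesgue measure on all `N
+ 1` particles (`lintegral_genericMarginal_propose`, abstracted in `Scheme.Regular`). Summing over
`k` shows that, given `z`, the reference index is distributed according to the normalised weights.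

This reduces everything to a frozen system `(z, W)` at time `t`: if `k` has law `W` and the later
reference states follow the path density started at `z k`, then the output is distributed as `z k`
followed by those states (`Regular.sum_lintegral_run`). The proof is by induction on the number of
later times. With none left, the claim is that the forced move preserves `W`, which is detailed
balance. Otherwise, averaging over `k` makes all ancestors independent draws from `W`
(`sum_mul_ancestorProb`); for fixed ancestors the density identity leads to a frozen system one time
later (`Regular.sum_lintegral_populate`); and backward sampling is Bayes' rule for the index at time
`t` given the state at time `t + 1` (`Regular.sum_mul_lintegral_backward`). -/

lemma lintegral_pi_prod {n : ℕ} {X : Type*} [MeasurableSpace X]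
    (μ : Fin n → Measure X) [∀ i, SigmaFinite (μ i)] (f : Fin n → X → ENNReal)
    (hf : ∀ i, Measurable (f i)) :
    ∫⁻ x, ∏ i, f i (x i) ∂Measure.pi μ = ∏ i, ∫⁻ x, f i x ∂μ i := by
  induction n with
  | zero => simp
  | succ n ih =>
    rw [← ((measurePreserving_piFinSuccAbove μ 0).symm).lintegral_comp_emb
      (MeasurableEquiv.measurableEmbedding _)]
    simp only [MeasurableEquiv.piFinSuccAbove_symm_apply, Fin.insertNthEquiv_apply,
      Fin.prod_univ_succ, Fin.insertNth_zero, Fin.cons_zero, Fin.cons_succ, cast_eq]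
    rw [lintegral_prod_mul (f := f 0) (g := fun y : Fin n → X => ∏ i : Fin n, f i.succ (y i))
      (hf 0).aemeasurable
      (Finset.measurable_fun_prod _ fun i _ => (hf _).comp (measurable_pi_apply i)).aemeasurable]
    congr 1
    exact ih (fun i => μ i.succ) (fun i => f i.succ) (fun i => hf _)

lemma pi_withDensity {n : ℕ} {X : Type*} [MeasurableSpace X]
    (μ : Fin n → Measure X) [∀ i, SigmaFinite (μ i)] (f : Fin n → X → ENNReal)
    (hf : ∀ i, Measurable (f i)) [∀ i, SigmaFinite ((μ i).withDensity (f i))] :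
    Measure.pi (fun i => (μ i).withDensity (f i)) =
      (Measure.pi μ).withDensity fun x => ∏ i, f i (x i) := by
  refine Measure.pi_eq fun s hs => ?_
  rw [withDensity_apply _ (MeasurableSet.univ_pi hs), Measure.restrict_pi_pi,
    lintegral_pi_prod _ _ hf]
  exact Finset.prod_congr rfl fun i _ => (withDensity_apply _ (hs i)).symm

/-! ### Gaussian densities -/

variable {D : ℕ}

lemma gaussianDensity_pos (μ : State D) {S : Matrix (Fin D) (Fin D) ℝ} (hS : S.PosDef)
    (x : State D) : 0 < gaussianDensity μ S x := by
  have := hS.det_pos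
  unfold gaussianDensity
  positivity

lemma continuous_bilin (A : Matrix (Fin D) (Fin D) ℝ) :
    Continuous fun p : State D × State D => bilin A p.1 p.2 := by
  unfold bilin
  simp only [dotProduct, Matrix.mulVec]
  fun_prop

@[fun_prop]
lemma measurable_bilin {X : Type*} [MeasurableSpace X] (A : Matrix (Fin D) (Fin D) ℝ)
    {f g : X → State D} (hf : Measurable f) (hg : Measurable g) :
    Measurable fun x => bilin A (f x) (g x) :=
  (continuous_bilin A).measurable.comp (hf.prodMk hg)

@[fun_prop]
lemma measurable_gaussianDensity {X : Type*} [MeasurableSpace X] (S : Matrix (Fin D) (Fin D) ℝ)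
    {f g : X → State D} (hf : Measurable f) (hg : Measurable g) :
    Measurable fun x => gaussianDensity (f x) S (g x) := by
  unfold gaussianDensity
  fun_prop

lemma stdGaussian_eq_withDensity : stdGaussian (State D) =
    volume.withDensity fun x => ENNReal.ofReal (gaussianDensity 0 1 x) := by
  rw [← map_pi_eq_stdGaussian]
  have h1 : (fun _ : Fin D => gaussianReal 0 1) =
      fun _ => (volume : Measure ℝ).withDensity (gaussianPDF 0 1) := by
    ext1 i; exact gaussianReal_of_var_ne_zero 0 one_ne_zero
  have : SigmaFinite ((volume : Measure ℝ).withDensity (gaussianPDF 0 1)) := by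
    rw [← gaussianReal_of_var_ne_zero 0 one_ne_zero]; infer_instance
  rw [h1, pi_withDensity _ _ (fun _ => measurable_gaussianPDF 0 1), ← volume_pi]
  ext1 s hs
  have hmp := EuclideanSpace.volume_preserving_symm_measurableEquiv_toLp (Fin D)
  rw [Measure.map_apply (by fun_prop) hs, withDensity_apply _ (by measurability),
    withDensity_apply _ hs, ← hmp.symm.setLIntegral_comp_preimage_emb
      (MeasurableEquiv.measurableEmbedding _)]
  refine lintegral_congr fun x => ?_
  simp only [gaussianPDF, gaussianPDFReal, gaussianDensity]
  rw [← ENNReal.ofReal_prod_of_nonneg (fun i _ => by positivity), Finset.prod_mul_distrib,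
    ← Real.exp_sum]
  congr 2
  · rw [Finset.prod_const, Finset.card_fin, inv_pow, NNReal.coe_one, mul_one, Matrix.det_one,
      mul_one]
    have h : (2 * Real.pi) ^ D = (√(2 * Real.pi) ^ D) ^ 2 := by
      rw [← pow_mul, mul_comm D 2, pow_mul, Real.sq_sqrt (by positivity)]
    rw [h, Real.sqrt_sq (by positivity)]
  · simp only [bilin, dotProduct, inv_one, Matrix.one_mulVec, sub_zero, Finset.mul_sum,
      NNReal.coe_one]
    refine congrArg _ (Finset.sum_congr rfl fun i _ => ?_)
    change _ = -(1 / 2) * (x i * x i)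
    ring

/-- For symmetric `A` the form moves onto `A * S⁻¹ * A`, which is the identity because `S = A * A`
with `A` invertible. -/
lemma bilin_inv_sqrt {S A : Matrix (Fin D) (Fin D) ℝ} (hS : S.PosDef) (hA : A.IsHermitian)
    (hAS : A * A = S) (x : State D) :
    bilin S⁻¹ (Matrix.toEuclideanCLM (𝕜 := ℝ) A x) (Matrix.toEuclideanCLM (𝕜 := ℝ) A x) =
      bilin 1 x x := by
  have hdet : IsUnit A.det := by
    have := hS.det_pos
    rw [← hAS, Matrix.det_mul] at this
    exact isUnit_iff_ne_zero.2 (by rintro h; simp [h] at this)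
  have h : A * (S⁻¹ * A) = 1 := by
    rw [← hAS, Matrix.mul_inv_rev, Matrix.mul_assoc, Matrix.nonsing_inv_mul _ hdet, Matrix.mul_one,
      Matrix.mul_nonsing_inv _ hdet]
  have hT : A.transpose = A := hA
  simp only [bilin, Matrix.ofLp_toEuclideanCLM]
  conv_lhs => enter [1]; rw [← hT]
  rw [Matrix.mulVec_transpose, ← Matrix.dotProduct_mulVec, Matrix.mulVec_mulVec,
    Matrix.mulVec_mulVec, Matrix.mul_assoc, h]

/-- Change of variables along `x ↦ μ + A x`, where `A` is the square root of `S`. The Jacobian `det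
A = √(det S)` is exactly the ratio of the two normalising constants. -/
theorem multivariateGaussian_eq_withDensity (μ : State D) {S : Matrix (Fin D) (Fin D) ℝ}
    (hS : S.PosDef) : multivariateGaussian μ S =
      volume.withDensity fun x => ENNReal.ofReal (gaussianDensity μ S x) := by
  open scoped MatrixOrder in
  set A := CFC.sqrt S with hA
  open scoped MatrixOrder in
  have hAS : A * A = S := CFC.sqrt_mul_sqrt_self _ hS.posSemidef.nonneg
  open scoped MatrixOrder in
  have hAp : A.PosSemidef := Matrix.nonneg_iff_posSemidef.1 (CFC.sqrt_nonneg S)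
  have hdet : A.det * A.det = S.det := by rw [← hAS, Matrix.det_mul]
  have hdet0 : 0 < A.det := by
    have := hS.det_pos
    have h2 := hAp.det_nonneg
    rcases h2.lt_or_eq with h | h
    · exact h
    · rw [← hdet, ← h] at this; simp at this
  set L : State D →ₗ[ℝ] State D := Matrix.toEuclideanLin A with hL
  have hLdet : LinearMap.det L = A.det :=
    LinearMap.det_toLpLin _ _
  rw [multivariateGaussian, stdGaussian_eq_withDensity]
  refine Measure.ext_of_lintegral _ fun f hf => ?_
  rw [lintegral_map hf (by fun_prop), lintegral_withDensity_eq_lintegral_mul _ (by fun_prop)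
    (by fun_prop), lintegral_withDensity_eq_lintegral_mul _ (by fun_prop) hf]
  conv_rhs => rw [← lintegral_add_left_eq_self _ μ]
  have hmap := Measure.map_linearMap_addHaar_eq_smul_addHaar (volume : Measure (State D))
    (f := L) (by rw [hLdet]; exact hdet0.ne')
  -- Lebesgue measure is rewritten as a pushforward under `L`, so that both sides become integrals
  -- over the same standard Gaussian variable.
  have hvol : (volume : Measure (State D)) = ENNReal.ofReal A.det • Measure.map L volume := by
    rw [hmap, smul_smul, hLdet, abs_of_pos (by positivity), ← ENNReal.ofReal_mul hdet0.le,
      mul_inv_cancel₀ hdet0.ne']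
    simp
  conv_rhs => rw [hvol]
  rw [lintegral_smul_measure, lintegral_map (by fun_prop) (by fun_prop), smul_eq_mul,
    ← lintegral_const_mul _ (by fun_prop)]
  refine lintegral_congr fun x => ?_
  simp only [Pi.mul_apply]
  rw [← mul_assoc, ← ENNReal.ofReal_mul hdet0.le]
  congr 2
  simp only [gaussianDensity, sub_zero, add_sub_cancel_left]
  rw [show L x = Matrix.toEuclideanCLM (𝕜 := ℝ) A x from rfl,
    bilin_inv_sqrt hS hAp.isHermitian hAS, ← hdet]
  simp only [Matrix.det_one, mul_one, inv_one]
  rw [Real.sqrt_mul (by positivity), Real.sqrt_mul_self hdet0.le]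
  field_simp

end ParticlePCNL

namespace ParticlePCNL

/-! ### Integrating out the auxiliary variable -/

section Bilin

variable {D : ℕ}

lemma bilin_add_left (A : Matrix (Fin D) (Fin D) ℝ) (x y z : State D) :
    bilin A (x + y) z = bilin A x z + bilin A y z := by
  simp [bilin]

lemma bilin_add_right (A : Matrix (Fin D) (Fin D) ℝ) (x y z : State D) :
    bilin A x (y + z) = bilin A x y + bilin A x z := by
  simp [bilin, Matrix.mulVec_add]

lemma bilin_sub_left (A : Matrix (Fin D) (Fin D) ℝ) (x y z : State D) :
    bilin A (x - y) z = bilin A x z - bilin A y z := by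
  simp [bilin]

lemma bilin_sub_right (A : Matrix (Fin D) (Fin D) ℝ) (x y z : State D) :
    bilin A x (y - z) = bilin A x y - bilin A x z := by
  simp [bilin, Matrix.mulVec_sub]

lemma bilin_smul_left (A : Matrix (Fin D) (Fin D) ℝ) (c : ℝ) (x y : State D) :
    bilin A (c • x) y = c * bilin A x y := by
  simp [bilin]

lemma bilin_smul_right (A : Matrix (Fin D) (Fin D) ℝ) (c : ℝ) (x y : State D) :
    bilin A x (c • y) = c * bilin A x y := by
  simp [bilin, Matrix.mulVec_smul]

lemma bilin_smul_matrix (A : Matrix (Fin D) (Fin D) ℝ) (c : ℝ) (x y : State D) :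
    bilin (c • A) x y = c * bilin A x y := by
  simp [bilin, Matrix.smul_mulVec]

lemma bilin_sum_left {ι : Type*} (s : Finset ι) (A : Matrix (Fin D) (Fin D) ℝ) (f : ι → State D)
    (x : State D) : bilin A (∑ i ∈ s, f i) x = ∑ i ∈ s, bilin A (f i) x := by
  simp [bilin, sum_dotProduct]

lemma bilin_comm {A : Matrix (Fin D) (Fin D) ℝ} (hA : A.IsHermitian) (x y : State D) :
    bilin A x y = bilin A y x := by
  have hT : A.transpose = A := hA
  unfold bilin
  conv_lhs => rw [← hT, Matrix.mulVec_transpose, dotProduct_comm, ← Matrix.dotProduct_mulVec]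

end Bilin

variable {D : ℕ}

/-- The normalising constant of the Gaussian density with covariance `S`. -/
noncomputable def gaussianConst (S : Matrix (Fin D) (Fin D) ℝ) : ℝ :=
  (Real.sqrt ((2 * Real.pi) ^ D * S.det))⁻¹

lemma gaussianConst_pos {S : Matrix (Fin D) (Fin D) ℝ} (hS : S.PosDef) : 0 < gaussianConst S := by
  have := hS.det_pos
  unfold gaussianConst
  positivity

lemma gaussianDensity_smul {c : ℝ} (hc : 0 < c) {C : Matrix (Fin D) (Fin D) ℝ} (hC : C.PosDef)
    (μ x : State D) : gaussianDensity μ (c • C) x =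
      gaussianConst (c • C) * Real.exp (-(1 / 2) * (c⁻¹ * bilin C⁻¹ (x - μ) (x - μ))) := by
  have : (c • C)⁻¹ = c⁻¹ • C⁻¹ := by
    have h := Matrix.inv_smul' C (Units.mk0 c hc.ne') (isUnit_iff_ne_zero.2 hC.det_pos.ne')
    simpa [Units.smul_def] using h
  rw [gaussianDensity, gaussianConst, this, bilin_smul_matrix]

lemma lintegral_gaussianDensity (μ : State D) {S : Matrix (Fin D) (Fin D) ℝ} (hS : S.PosDef) :
    ∫⁻ x, ENNReal.ofReal (gaussianDensity μ S x) = 1 := by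
  have h : multivariateGaussian μ S Set.univ = 1 := measure_univ
  rwa [multivariateGaussian_eq_withDensity μ hS, withDensity_apply _ MeasurableSet.univ,
    Measure.restrict_univ] at h

lemma integrable_gaussianDensity (μ : State D) {S : Matrix (Fin D) (Fin D) ℝ} (hS : S.PosDef) :
    Integrable (gaussianDensity μ S) := by
  refine ⟨(measurable_gaussianDensity S measurable_const measurable_id).aestronglyMeasurable, ?_⟩
  rw [hasFiniteIntegral_iff_ofReal (ae_of_all _ fun x => (gaussianDensity_pos μ hS x).le),
    lintegral_gaussianDensity μ hS]
  exact ENNReal.one_lt_top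

lemma integral_gaussianDensity (μ : State D) {S : Matrix (Fin D) (Fin D) ℝ} (hS : S.PosDef) :
    ∫ x, gaussianDensity μ S x = 1 := by
  rw [integral_eq_lintegral_of_nonneg_ae (ae_of_all _ fun x => (gaussianDensity_pos μ hS x).le)
    (integrable_gaussianDensity μ hS).1, lintegral_gaussianDensity μ hS]
  rfl

lemma beta_pos {δ : ℝ} (hδ : 0 < δ) : 0 < beta δ := by unfold beta; positivity

lemma one_sub_beta_pos {δ : ℝ} (hδ : 0 < δ) : 0 < 1 - beta δ := by
  have : beta δ < 1 := by unfold beta; rw [div_lt_one] <;> linarith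
  linarith

/-- Expresses all covariances through `β` alone. It also gives `E⁻¹` and `β R⁻¹` the common value `β
/ (1 - β) C⁻¹`, which is why the posterior mean of `u` below is an unweighted sum. -/
lemma half_eq_beta {δ : ℝ} (hδ : 0 < δ) : δ / 2 = (1 - beta δ) / beta δ := by
  unfold beta; field_simp; ring

lemma toEuclideanLin_smul_one (c : ℝ) (u : State D) :
    Matrix.toEuclideanLin (c • (1 : Matrix (Fin D) (Fin D) ℝ)) u = c • u := by
  ext i; simp

namespace Model

variable (F : Model D) (N : ℕ) (δ : ℕ → ℝ)

/-- The part of the marginalised proposal density that does not depend on the reference index. -/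
noncomputable def commonFactor (t : ℕ) (v z : Particles D N) : ℝ :=
  gaussianConst ((δ t / 2) • F.C t) * gaussianConst ((1 - beta (δ t)) • F.C t) ^ N *
    (gaussianConst (((1 - beta (δ t)) / (beta (δ t) * (1 + N * beta (δ t)))) • F.C t))⁻¹ *
    Real.exp (-(1 / 2) * ((1 - beta (δ t))⁻¹ * ∑ l, bilin (F.C t)⁻¹ (z l - v l) (z l - v l)) +
      1 / 2 * bilin (F.gainMatrix N δ t) (∑ l, (z l - v l)) (∑ l, (z l - v l)))

variable {F N δ}

/-- The coefficient of `C⁻¹` in the precision of `u` is `β / (1 - β) + N β² / (1 - β) = β (1 + N β)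
/ (1 - β)`, one term from the auxiliary density and one from each of the `N` other particles. The
terms free of `u` are grouped into a part independent of `n` and the log weight factor. -/
lemma complete_square (t : ℕ) (hC : (F.C t).PosDef) (hδ : 0 < δ t) (phi v z : Particles D N)
    (n : Fin (N + 1)) (u : State D) :
    -(1 / 2) * ((δ t / 2)⁻¹ * bilin (F.C t)⁻¹ (u - (z n + phi n)) (u - (z n + phi n))) +
      ∑ l ∈ Finset.univ.erase n, -(1 / 2) * ((1 - beta (δ t))⁻¹ *
        bilin (F.C t)⁻¹ (z l - (v l + beta (δ t) • u)) (z l - (v l + beta (δ t) • u))) =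
    -(1 / 2) * (((1 - beta (δ t)) / (beta (δ t) * (1 + N * beta (δ t))))⁻¹ *
        bilin (F.C t)⁻¹
          (u - (1 + N * beta (δ t))⁻¹ • (z n + phi n + ∑ l, (z l - v l) - (z n - v n)))
          (u - (1 + N * beta (δ t))⁻¹ • (z n + phi n + ∑ l, (z l - v l) - (z n - v n)))) +
      (-(1 / 2) * ((1 - beta (δ t))⁻¹ * ∑ l, bilin (F.C t)⁻¹ (z l - v l) (z l - v l)) +
      1 / 2 * bilin (F.gainMatrix N δ t) (∑ l, (z l - v l)) (∑ l, (z l - v l))) +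
      F.logWeightFactor N δ t (phi n) (z n) (v n) (((N : ℝ) + 1)⁻¹ • ∑ l, z l)
        (((N : ℝ) + 1)⁻¹ • ∑ l, v l) := by
  have hb := beta_pos hδ
  have hb1 := one_sub_beta_pos hδ
  rw [half_eq_beta hδ]
  set b := beta (δ t) with hb_def
  set P := (F.C t)⁻¹ with hP
  have hsymm : P.IsHermitian := hC.isHermitian.inv
  have hbar : (N + 1) * bilin (F.gainMatrix N δ t)
      ((((N : ℝ) + 1)⁻¹ • ∑ l, z l) - ((N : ℝ) + 1)⁻¹ • ∑ l, v l) (v n + phi n) =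
      bilin (F.gainMatrix N δ t) (∑ l, (z l - v l)) (v n + phi n) := by
    rw [← smul_sub, bilin_smul_left, Finset.sum_sub_distrib, ← mul_assoc,
      mul_inv_cancel₀ (by positivity), one_mul]
  have hsum : ∑ l, bilin P (z l - (v l + b • u)) (z l - (v l + b • u)) =
      ∑ l, bilin P (z l - v l) (z l - v l) - 2 * b * bilin P (∑ l, (z l - v l)) u +
        (N + 1) * b ^ 2 * bilin P u u := by
    rw [bilin_sum_left, Finset.mul_sum, ← Finset.sum_sub_distrib]
    have : (N + 1) * b ^ 2 * bilin P u u = ∑ _l : Fin (N + 1), b ^ 2 * bilin P u u := by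
      simp; ring
    rw [this, ← Finset.sum_add_distrib]
    refine Finset.sum_congr rfl fun l _ => ?_
    rw [← sub_sub, bilin_sub_left, bilin_sub_right, bilin_sub_right _ (b • u), bilin_smul_left,
      bilin_smul_right, bilin_smul_left, bilin_smul_right, bilin_comm hsymm u]
    ring
  rw [logWeightFactor, hbar, gainMatrix, ← hb_def, ← hP, Finset.sum_erase_eq_sub (Finset.mem_univ n),
    ← Finset.mul_sum, ← Finset.mul_sum, hsum]
  have h1 : z n - (v n + b • u) = z n - v n - b • u := by abel
  -- All vectors are expressed through `a = z n + phi n`, `y = z n - v n`, the total `s` and `u`.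
  -- After expansion and symmetrisation the claim is a rational identity in their pairings.
  have h2 : v n + phi n = z n + phi n - (z n - v n) := by abel
  rw [h1, h2]
  generalize z n + phi n = a
  generalize z n - v n = y
  generalize ∑ l, (z l - v l) = s
  generalize ∑ l, bilin P (z l - v l) (z l - v l) = Y
  simp only [bilin_smul_matrix, bilin_add_left, bilin_add_right, bilin_sub_left, bilin_sub_right,
    bilin_smul_left, bilin_smul_right]
  rw [bilin_comm hsymm a u, bilin_comm hsymm y u, bilin_comm hsymm s u, bilin_comm hsymm s a,
    bilin_comm hsymm y a, bilin_comm hsymm y s]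
  have hb2 : 0 < 1 + N * b := by positivity
  field_simp
  ring

lemma gainScale_pos {b : ℝ} (hb : 0 < b) (hb1 : 0 < 1 - b) (N : ℕ) :
    0 < (1 - b) / (b * (1 + N * b)) := by
  positivity

lemma marginalIntegrand_eq (t : ℕ) (hC : (F.C t).PosDef) (hδ : 0 < δ t) (phi v z : Particles D N)
    (n : Fin (N + 1)) (u : State D) :
    gaussianDensity (z n + phi n) ((δ t / 2) • F.C t) u *
      ∏ l ∈ Finset.univ.erase n, gaussianDensity (v l + Matrix.toEuclideanLin
        (beta (δ t) • (1 : Matrix (Fin D) (Fin D) ℝ)) u) ((1 - beta (δ t)) • F.C t) (z l) =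
    F.commonFactor N δ t v z * Real.exp (F.logWeightFactor N δ t (phi n) (z n) (v n)
        (((N : ℝ) + 1)⁻¹ • ∑ l, z l) (((N : ℝ) + 1)⁻¹ • ∑ l, v l)) *
      gaussianDensity ((1 + N * beta (δ t))⁻¹ • (z n + phi n + ∑ l, (z l - v l) - (z n - v n)))
        (((1 - beta (δ t)) / (beta (δ t) * (1 + N * beta (δ t)))) • F.C t) u := by
  have hb := beta_pos hδ
  have hb1 := one_sub_beta_pos hδ
  have hS := gainScale_pos hb hb1 N
  have hK := (gaussianConst_pos (hC.smul hS)).ne'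
  simp only [toEuclideanLin_smul_one]
  rw [gaussianDensity_smul (by positivity) hC, gaussianDensity_smul hS hC, commonFactor]
  simp only [gaussianDensity_smul hb1 hC]
  rw [Finset.prod_mul_distrib, Finset.prod_const, Finset.card_erase_of_mem (Finset.mem_univ n),
    Finset.card_fin, Nat.add_sub_cancel, ← Real.exp_sum, mul_mul_mul_comm, ← Real.exp_add,
    complete_square t hC hδ, Real.exp_add, Real.exp_add]
  generalize gaussianConst (((1 - beta (δ t)) / (beta (δ t) * (1 + N * beta (δ t)))) • F.C t) = K
    at hK ⊢
  field_simp

lemma commonFactor_pos (t : ℕ) (hC : (F.C t).PosDef) (hδ : 0 < δ t) (v z : Particles D N) :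
    0 < F.commonFactor N δ t v z := by
  have hb1 := one_sub_beta_pos hδ
  have h1 := gaussianConst_pos (hC.smul (gainScale_pos (beta_pos hδ) hb1 N))
  have h2 := gaussianConst_pos (hC.smul hb1)
  have h3 := gaussianConst_pos (hC.smul (half_pos hδ))
  unfold commonFactor
  positivity

/-- `marginalProposal` is a Bochner integral; integrability is what allows it to be exchanged for a
Lebesgue integral in the density identity. -/
lemma integrable_marginalIntegrand (t : ℕ) (hC : (F.C t).PosDef) (hδ : 0 < δ t)
    (phi v z : Particles D N) (n : Fin (N + 1)) :
    Integrable fun u => gaussianDensity (z n + phi n) ((δ t / 2) • F.C t) u *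
      ∏ l ∈ Finset.univ.erase n, gaussianDensity (v l + Matrix.toEuclideanLin
        (beta (δ t) • (1 : Matrix (Fin D) (Fin D) ℝ)) u) ((1 - beta (δ t)) • F.C t) (z l) := by
  simp only [marginalIntegrand_eq t hC hδ]
  exact (integrable_gaussianDensity _
    (hC.smul (gainScale_pos (beta_pos hδ) (one_sub_beta_pos hδ) N))).const_mul _

/-- The marginalised proposal density agrees with the weight factor of the Particle-PCNL algorithm
up to a factor which does not depend on the reference index. -/
theorem marginalProposal_eq (t : ℕ) (hC : (F.C t).PosDef) (hδ : 0 < δ t)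
    (phi v z : Particles D N) (n : Fin (N + 1)) :
    marginalProposal phi v (beta (δ t) • (1 : Matrix (Fin D) (Fin D) ℝ))
      ((1 - beta (δ t)) • F.C t) ((δ t / 2) • F.C t) z n =
    F.commonFactor N δ t v z * Real.exp (F.logWeightFactor N δ t (phi n) (z n) (v n)
        (((N : ℝ) + 1)⁻¹ • ∑ l, z l) (((N : ℝ) + 1)⁻¹ • ∑ l, v l)) := by
  unfold marginalProposal
  simp only [marginalIntegrand_eq t hC hδ]
  rw [integral_const_mul, integral_gaussianDensity _
    (hC.smul (gainScale_pos (beta_pos hδ) (one_sub_beta_pos hδ) N)), mul_one]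

lemma normalize_mul_left {w : Fin (N + 1) → ℝ} {c : ℝ} (hc : c ≠ 0) :
    normalize (fun n => c * w n) = normalize w := by
  ext n
  simp only [normalize, ← Finset.mul_sum]
  exact mul_div_mul_left _ _ hc

end Model

/-! ### Equality of the two output laws -/

/-- Unnormalised weights enter only through `populate`, which normalises them, so schemes whose
weights differ by a factor common to all particles are covered. -/
lemma Scheme.law_congr {N : ℕ} {A B : Scheme D N} (hQ : A.Q = B.Q)
    (hpop : A.populate = B.populate) (S : ℕ) (x : Fin (S + 1) → State D) :
    A.law S x = B.law S x := by
  have hinit : A.initial = B.initial := by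
    funext x; simp only [Scheme.initial, hpop]
  have hstep : A.step = B.step := by
    funext t s x; simp only [Scheme.step, hpop]
  have hback : A.backward = B.backward := by
    funext t s x; simp only [Scheme.backward, hQ]
  have hrun : ∀ r, A.run r = B.run r := by
    intro r
    induction r with
    | zero => funext t s x; simp only [Scheme.run]
    | succ r ih => funext t s x; simp only [Scheme.run, hstep, ih, hback]
  simp only [Scheme.law, hinit, hrun]

namespace Model
variable {F : Model D} {N : ℕ} {δ : ℕ → ℝ}

theorem law_pcnl_eq_law_genericMarginal (hC : ∀ t, (F.C t).PosDef) (hδ : ∀ t, 0 < δ t) (κ : ℝ)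
    (Cpre : ℕ → State D → Matrix (Fin D) (Fin D) ℝ) (S : ℕ) (x : Fin (S + 1) → State D) :
    (F.pcnl N δ κ Cpre).law S x =
      (genericMarginal N F.Q (F.drift δ κ Cpre) (F.offset δ)
        (fun t => beta (δ t) • (1 : Matrix (Fin D) (Fin D) ℝ))
        (fun t => (1 - beta (δ t)) • F.C t) (fun t => (δ t / 2) • F.C t)).law S x := by
  refine Scheme.law_congr ?_ ?_ S x
  · rfl
  funext t prev k x
  have hw : ∀ z, normalize ((F.pcnl N δ κ Cpre).weight t prev z) =
      normalize ((genericMarginal N F.Q (F.drift δ κ Cpre) (F.offset δ)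
        (fun t => beta (δ t) • (1 : Matrix (Fin D) (Fin D) ℝ))
        (fun t => (1 - beta (δ t)) • F.C t) (fun t => (δ t / 2) • F.C t)).weight t prev z) := by
    intro z
    rw [← normalize_mul_left (commonFactor_pos t (hC t) (hδ t) (fun l => F.offset δ t (prev l))
      z).ne']
    congr 1
    funext n
    simp only [pcnl, genericMarginal, marginalProposal_eq t (hC t) (hδ t)]
    exact mul_left_comm _ _ _
  have hp : (F.pcnl N δ κ Cpre).propose t prev k x =
      (genericMarginal N F.Q (F.drift δ κ Cpre) (F.offset δ)
        (fun t => beta (δ t) • (1 : Matrix (Fin D) (Fin D) ℝ))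
        (fun t => (1 - beta (δ t)) • F.C t) (fun t => (δ t / 2) • F.C t)).propose t prev k x := by
    simp only [pcnl, genericMarginal, toEuclideanLin_smul_one, offset, add_comm]
  simp only [Scheme.populate, hp, hw]

end Model
end ParticlePCNL

namespace ParticlePCNL

/-! ### The law of the particles around the reference particle -/

variable {D N : ℕ}

open scoped MatrixOrder in
/-- The linear map that turns a standard Gaussian vector into one with covariance matrix `R`. -/
noncomputable def gaussianRoot (R : Matrix (Fin D) (Fin D) ℝ) : State D →L[ℝ] State D :=
  Matrix.toEuclideanCLM (𝕜 := ℝ) (CFC.sqrt R)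

/-- The law of the particles whose reference particle, with index `k`, has value `x` and whose
other particles are independent Gaussians with means `μ n` and covariance matrix `R`. -/
noncomputable def refresh (R : Matrix (Fin D) (Fin D) ℝ) (k : Fin (N + 1)) (x : State D)
    (μ : Particles D N) : Measure (Particles D N) :=
  Measure.pi fun n => if n = k then Measure.dirac x else multivariateGaussian (μ n) R

instance (R : Matrix (Fin D) (Fin D) ℝ) (k n : Fin (N + 1)) (x : State D) (μ : Particles D N) :
    IsProbabilityMeasure (if n = k then Measure.dirac x else multivariateGaussian (μ n) R) := by
  split_ifs <;> infer_instance

instance (R : Matrix (Fin D) (Fin D) ℝ) (k : Fin (N + 1)) (x : State D) (μ : Particles D N) :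
    IsProbabilityMeasure (refresh R k x μ) := by
  unfold refresh; infer_instance

/-- The noise is separated from the parameters: the law is the image of a fixed measure, so its
measurable dependence on `x` and `μ` follows from joint measurability of a map. -/
lemma refresh_eq_map (R : Matrix (Fin D) (Fin D) ℝ) (k : Fin (N + 1)) (x : State D)
    (μ : Particles D N) :
    refresh R k x μ = (Measure.pi fun _ : Fin (N + 1) => stdGaussian (State D)).map
      fun w n => if n = k then x else μ n + gaussianRoot R (w n) := by
  have h : ∀ n : Fin (N + 1), (if n = k then Measure.dirac x else multivariateGaussian (μ n) R) =
      (stdGaussian (State D)).map fun w =>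
        if n = k then x else μ n + gaussianRoot R w := by
    intro n
    split_ifs with hn
    · simp
    · rfl
  have hm : ∀ n : Fin (N + 1), Measurable fun w : State D =>
      if n = k then x else μ n + gaussianRoot R w := by
    intro n
    split_ifs <;> fun_prop
  have : ∀ n, IsProbabilityMeasure ((stdGaussian (State D)).map fun w =>
        if n = k then x else μ n + gaussianRoot R w) :=
    fun n => Measure.isProbabilityMeasure_map (hm n).aemeasurable
  unfold refresh
  simp only [h]
  exact (Measure.pi_map_pi (μ := fun _ => stdGaussian (State D))
    fun n => (hm n).aemeasurable).symm

lemma measurable_map_of_measurable {X Y Z : Type*} [MeasurableSpace X] [MeasurableSpace Y]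
    [MeasurableSpace Z] (ν : Measure Y) [SFinite ν] {h : X × Y → Z} (hh : Measurable h) :
    Measurable fun x => ν.map fun y => h (x, y) := by
  have : (fun x => ν.map fun y => h (x, y)) = fun x => (ν.map (Prod.mk x)).map h := by
    funext x
    rw [Measure.map_map hh (by fun_prop)]
    rfl
  rw [this]
  exact (Measure.measurable_map h hh).comp Measurable.map_prodMk_left

lemma measurable_refresh {X : Type*} [MeasurableSpace X] (R : Matrix (Fin D) (Fin D) ℝ)
    (k : Fin (N + 1)) {f : X → State D} {g : X → Particles D N} (hf : Measurable f)
    (hg : Measurable g) : Measurable fun p => refresh R k (f p) (g p) := by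
  simp only [refresh_eq_map]
  refine measurable_map_of_measurable _ (h := fun p : X × Particles D N => fun n =>
    if n = k then f p.1 else g p.1 n + gaussianRoot R (p.2 n)) ?_
  refine measurable_pi_lambda _ fun n => ?_
  split_ifs
  · fun_prop
  · fun_prop

lemma measurable_multivariateGaussian {X : Type*} [MeasurableSpace X]
    (R : Matrix (Fin D) (Fin D) ℝ) {f : X → State D} (hf : Measurable f) :
    Measurable fun p => multivariateGaussian (f p) R :=
  measurable_map_of_measurable _ (h := fun p : X × State D =>
    f p.1 + gaussianRoot R p.2) (by fun_prop)

lemma prod_erase_eq_prod_succAbove {M : Type*} [CommMonoid M] (k : Fin (N + 1))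
    (f : Fin (N + 1) → M) : ∏ l ∈ Finset.univ.erase k, f l = ∏ j, f (k.succAbove j) := by
  rw [← Finset.compl_singleton, ← Fin.image_succAbove_univ,
    Finset.prod_image fun _ _ _ _ h => Fin.succAbove_right_injective h]

lemma lintegral_insertNth (k : Fin (N + 1)) (f : Particles D N → ENNReal) (hf : Measurable f) :
    ∫⁻ z, f z = ∫⁻ x : State D, ∫⁻ y : Fin N → State D, f (k.insertNth x y) := by
  rw [← ((volume_preserving_piFinSuccAbove (fun _ : Fin (N + 1) => State D) k).symm).lintegral_comp
    hf, Measure.volume_eq_prod, lintegral_prod _ (by fun_prop)]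
  rfl

lemma measurable_insertNth (k : Fin (N + 1)) :
    Measurable fun p : State D × (Fin N → State D) => (k.insertNth p.1 p.2 : Particles D N) :=
  (MeasurableEquiv.piFinSuccAbove (fun _ : Fin (N + 1) => State D) k).symm.measurable

lemma lintegral_refresh {R : Matrix (Fin D) (Fin D) ℝ} (hR : R.PosDef) (k : Fin (N + 1))
    (x : State D) (μ : Particles D N) (f : Particles D N → ENNReal) (hf : Measurable f) :
    ∫⁻ z, f z ∂refresh R k x μ = ∫⁻ y : Fin N → State D,
      (∏ j, ENNReal.ofReal (gaussianDensity (μ (k.succAbove j)) R (y j))) *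
        f (k.insertNth x y) := by
  have hsf : ∀ j : Fin N, SigmaFinite ((volume : Measure (State D)).withDensity
      fun y => ENNReal.ofReal (gaussianDensity (μ (k.succAbove j)) R y)) := fun j => by
    rw [← multivariateGaussian_eq_withDensity _ hR]; infer_instance
  unfold refresh
  rw [← ((measurePreserving_piFinSuccAbove (fun n => if n = k then Measure.dirac x else
    multivariateGaussian (μ n) R) k).symm).lintegral_comp hf]
  simp only [if_true, Fin.succAbove_ne, if_false]
  rw [Measure.dirac_prod, lintegral_map (by fun_prop) (by fun_prop)]
  simp only [multivariateGaussian_eq_withDensity _ hR]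
  rw [pi_withDensity _ _ (fun j => by fun_prop),
    lintegral_withDensity_eq_lintegral_mul _ (by fun_prop)
      (by fun_prop)]
  rfl

/-- Tonelli's theorem for the auxiliary variable. In the application `c` is the value of `Q_t`, `g`
the density of `u`, and `P` the density of the non-reference particles given `u`; the inner integral
on the right is then the marginal proposal density. -/
lemma lintegral_withDensity_swap {U Y : Type*} [MeasurableSpace U] [MeasurableSpace Y]
    (μ : Measure U) (ν : Measure Y) [SFinite μ] [SFinite ν] (c : ENNReal) {g : U → ENNReal}
    {P : Y × U → ENNReal} {h : Y → ENNReal} (hg : Measurable g) (hP : Measurable P)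
    (hh : Measurable h) :
    c * ∫⁻ u, ∫⁻ y, P (y, u) * h y ∂ν ∂(μ.withDensity g) =
      ∫⁻ y, (c * ∫⁻ u, g u * P (y, u) ∂μ) * h y ∂ν := by
  have hPh : Measurable fun p : U × Y => P (p.2, p.1) * h p.2 := by fun_prop
  rw [lintegral_withDensity_eq_lintegral_mul _ hg hPh.lintegral_prod_right']
  have h1 : ∀ u, (g * fun u => ∫⁻ y, P (y, u) * h y ∂ν) u =
      ∫⁻ y, g u * P (y, u) * h y ∂ν := fun u => by
    simp only [Pi.mul_apply, mul_assoc]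
    exact (lintegral_const_mul _ (by fun_prop)).symm
  have hgP : Measurable fun y => ∫⁻ u, g u * P (y, u) ∂μ :=
    (show Measurable fun p : Y × U => g p.2 * P p by fun_prop).lintegral_prod_right'
  rw [lintegral_congr h1, lintegral_lintegral_swap (by fun_prop)]
  simp only [mul_assoc c]
  rw [lintegral_const_mul _ (by fun_prop)]
  congr 1
  refine lintegral_congr fun y => ?_
  rw [lintegral_mul_const _ (by fun_prop)]

/-! ### Joint density of the reference state and the particles -/

section GenericMarginal

variable {Q : ℕ → State D → State D → ℝ} {phi : ℕ → State D → State D → State D}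
  {v : ℕ → State D → State D} {H R E : ℕ → Matrix (Fin D) (Fin D) ℝ}

lemma measurable_toEuclideanLin (A : Matrix (Fin D) (Fin D) ℝ) :
    Measurable (Matrix.toEuclideanLin A : State D → State D) :=
  (LinearMap.continuous_of_finiteDimensional _).measurable

lemma genericMarginal_propose (t : ℕ) (prev : Particles D N) (k : Fin (N + 1)) (x : State D) :
    (genericMarginal N Q phi v H R E).propose t prev k x =
      (multivariateGaussian (x + phi t (prev k) x) (E t)).bind fun u =>
        refresh (R t) k x fun n => v t (prev n) + Matrix.toEuclideanLin (H t) u :=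
  rfl

lemma measurable_refresh_shift (t : ℕ) (prev : Particles D N) (k : Fin (N + 1)) (x : State D) :
    Measurable fun u : State D =>
      refresh (R t) k x fun n => v t (prev n) + Matrix.toEuclideanLin (H t) u :=
  measurable_refresh _ _ measurable_const
    (measurable_pi_lambda _ fun _ => (measurable_toEuclideanLin _).const_add _)

lemma ofReal_marginalProposal {w phi' : Particles D N} {H R E : Matrix (Fin D) (Fin D) ℝ}
    (hR : R.PosDef) (hE : E.PosDef) (k : Fin (N + 1)) (x : State D) (y : Fin N → State D)
    (hint : Integrable fun u => gaussianDensity (x + phi' k) E u *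
      ∏ l ∈ Finset.univ.erase k,
        gaussianDensity (w l + Matrix.toEuclideanLin H u) R ((k.insertNth x y : Particles D N) l)) :
    ENNReal.ofReal (marginalProposal phi' w H R E (k.insertNth x y) k) =
      ∫⁻ u, ENNReal.ofReal (gaussianDensity (x + phi' k) E u) *
        ∏ j, ENNReal.ofReal
          (gaussianDensity (w (k.succAbove j) + Matrix.toEuclideanLin H u) R (y j)) := by
  unfold marginalProposal
  rw [Fin.insertNth_apply_same, ofReal_integral_eq_lintegral_ofReal hint]
  · refine lintegral_congr fun u => ?_
    rw [ENNReal.ofReal_mul (gaussianDensity_pos _ hE _).le, prod_erase_eq_prod_succAbove,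
      ENNReal.ofReal_prod_of_nonneg fun j _ => (gaussianDensity_pos _ hR _).le]
    simp only [Fin.insertNth_apply_succAbove]
  · exact ae_of_all _ fun u => mul_nonneg (gaussianDensity_pos _ hE _).le
      (Finset.prod_nonneg fun l _ => (gaussianDensity_pos _ hR _).le)

/-- The weight of the reference particle is the joint density of the particles under the
unnormalised target and the proposal. -/
theorem lintegral_genericMarginal_propose (t : ℕ) (prev : Particles D N) (k : Fin (N + 1))
    (hR : (R t).PosDef) (hE : (E t).PosDef) (hQ0 : ∀ x, 0 ≤ Q t (prev k) x)
    (hint : ∀ z : Particles D N, Integrable fun u =>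
      gaussianDensity (z k + phi t (prev k) (z k)) (E t) u * ∏ l ∈ Finset.univ.erase k,
        gaussianDensity (v t (prev l) + Matrix.toEuclideanLin (H t) u) (R t) (z l))
    (hw : Measurable fun z => (genericMarginal N Q phi v H R E).weight t prev z k)
    {f : State D × Particles D N → ENNReal} (hf : Measurable f) :
    ∫⁻ x, ENNReal.ofReal (Q t (prev k) x) *
        ∫⁻ z, f (x, z) ∂(genericMarginal N Q phi v H R E).propose t prev k x =
      ∫⁻ z, ENNReal.ofReal ((genericMarginal N Q phi v H R E).weight t prev z k) * f (z k, z) := by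
  -- Coordinate `k` of `z` plays the role of the reference state `x`, so after splitting it off the
  -- two outer integrals can be compared pointwise.
  rw [lintegral_insertNth k _ (by fun_prop)]
  refine lintegral_congr fun x => ?_
  have hins := measurable_insertNth (D := D) k
  have hlin := measurable_toEuclideanLin (H t)
  have hins' : Measurable fun y : Fin N → State D => (k.insertNth x y : Particles D N) :=
    hins.comp measurable_prodMk_left
  have hfx : Measurable fun z => f (x, z) := hf.comp measurable_prodMk_left
  have hfy : Measurable fun y => f (x, (k.insertNth x y : Particles D N)) := hfx.comp hins'
  rw [genericMarginal_propose, Measure.lintegral_bind (measurable_refresh_shift ..).aemeasurable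
    hfx.aemeasurable, multivariateGaussian_eq_withDensity _ hE]
  simp only [lintegral_refresh hR _ _ _ _ hfx]
  have hprod : Measurable fun p : (Fin N → State D) × State D => ∏ j, ENNReal.ofReal
      (gaussianDensity (v t (prev (k.succAbove j)) + Matrix.toEuclideanLin (H t) p.2) (R t)
        (p.1 j)) := by
    refine Finset.measurable_fun_prod _ fun j _ => ENNReal.measurable_ofReal.comp ?_
    exact measurable_gaussianDensity _ ((hlin.comp measurable_snd).const_add _) (by fun_prop)
  have hgE : Measurable fun u => ENNReal.ofReal (gaussianDensity (x + phi t (prev k) x) (E t) u) :=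
    ENNReal.measurable_ofReal.comp (measurable_gaussianDensity _ measurable_const measurable_id)
  refine (lintegral_withDensity_swap _ _ _ hgE hprod hfy).trans (lintegral_congr fun y => ?_)
  rw [Fin.insertNth_apply_same]
  congr 1
  have hz := hint (k.insertNth x y)
  rw [Fin.insertNth_apply_same] at hz
  have hm := ofReal_marginalProposal (w := fun l => v t (prev l)) (H := H t)
    (phi' := fun l => phi t (prev l) ((k.insertNth x y : Particles D N) l)) hR hE k x y
    (by simpa only [Fin.insertNth_apply_same] using hz)
  simp only [genericMarginal, Fin.insertNth_apply_same] at hm ⊢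
  rw [ENNReal.ofReal_mul (hQ0 x), hm]

end GenericMarginal

end ParticlePCNL

namespace ParticlePCNL

/-! ### Measure-valued functions that are s-finite kernels -/

section IsKernelFun

variable {X Y Z : Type*} [MeasurableSpace X] [MeasurableSpace Y] [MeasurableSpace Z]

/-- A measure-valued function which underlies an s-finite kernel. -/
def IsKernelFun (f : X → Measure Y) : Prop :=
  ∃ κ : Kernel X Y, IsSFiniteKernel κ ∧ ∀ a, κ a = f a

namespace IsKernelFun

lemma measurable {f : X → Measure Y} (hf : IsKernelFun f) : Measurable f := by
  obtain ⟨κ, -, h⟩ := hf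
  rw [← funext h]
  exact κ.measurable

lemma of_isProbabilityMeasure {f : X → Measure Y} (hf : Measurable f)
    (h : ∀ a, IsProbabilityMeasure (f a)) : IsKernelFun f := by
  have : IsMarkovKernel (⟨f, hf⟩ : Kernel X Y) := ⟨h⟩
  exact ⟨⟨f, hf⟩, inferInstance, fun _ => rfl⟩

lemma comp {f : Y → Measure Z} (hf : IsKernelFun f) {g : X → Y} (hg : Measurable g) :
    IsKernelFun fun a => f (g a) := by
  obtain ⟨κ, hκ, h⟩ := hf
  exact ⟨κ.comap g hg, inferInstance, fun a => h (g a)⟩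

/-- The bind is the second marginal of the composition product, for which s-finiteness suffices.
Markov kernels would be too narrow: a `Slice` carries an arbitrary real vector of weights, for which
`categorical` need not be a probability. -/
lemma bind {f : X → Measure Y} {g : X × Y → Measure Z} (hf : IsKernelFun f)
    (hg : IsKernelFun g) : IsKernelFun fun a => (f a).bind fun b => g (a, b) := by
  have hgm := hg.measurable
  obtain ⟨κ, hκ, h⟩ := hf
  obtain ⟨η, hη, h'⟩ := hg
  refine ⟨(κ.compProd η).snd, inferInstance, fun a => ?_⟩
  ext s hs
  change _ = ((f a).bind fun b => g (a, b)) s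
  rw [Kernel.snd_apply' _ _ hs, Kernel.compProd_apply (measurable_snd hs),
    Measure.bind_apply (f := fun b => g (a, b)) hs (hgm.comp measurable_prodMk_left).aemeasurable,
    ← h]
  refine lintegral_congr fun b => ?_
  rw [← h']
  rfl

lemma measurable_lintegral {f : X → Measure Y} (hf : IsKernelFun f) {g : X × Y → ENNReal}
    (hg : Measurable g) : Measurable fun a => ∫⁻ b, g (a, b) ∂f a := by
  obtain ⟨κ, hκ, h⟩ := hf
  simp only [← h]
  exact hg.lintegral_kernel_prod_right'

lemma dirac {g : X → Y} (hg : Measurable g) : IsKernelFun fun a => Measure.dirac (g a) :=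
  of_isProbabilityMeasure (Measure.measurable_dirac.comp hg) fun _ => inferInstance

lemma map {f : X → Measure Y} {g : X × Y → Z} (hf : IsKernelFun f) (hg : Measurable g) :
    IsKernelFun fun a => (f a).map fun b => g (a, b) := by
  have := hf.bind (dirac hg)
  convert this using 2 with a
  exact (Measure.bind_dirac_eq_map _ (hg.comp measurable_prodMk_left)).symm

lemma smul {f : X → Measure Y} (hf : IsKernelFun f) {c : X → ENNReal} (hc : Measurable c)
    (hc' : ∀ a, c a ≠ ⊤) : IsKernelFun fun a => c a • f a := by
  obtain ⟨κ, hκ, h⟩ := hf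
  refine ⟨κ.withDensity fun a _ => c a, Kernel.IsSFiniteKernel.withDensity _ fun a _ => hc' a,
    fun a => ?_⟩
  rw [Kernel.withDensity_apply _ (by fun_prop), withDensity_const, h]

lemma zero : IsKernelFun fun _ : X => (0 : Measure Y) :=
  ⟨0, inferInstance, fun _ => rfl⟩

lemma add {f g : X → Measure Y} (hf : IsKernelFun f) (hg : IsKernelFun g) :
    IsKernelFun fun a => f a + g a := by
  obtain ⟨κ, hκ, h⟩ := hf
  obtain ⟨η, hη, h'⟩ := hg
  exact ⟨κ + η, inferInstance, fun a => by simp only [← h, ← h']; rfl⟩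

lemma sum {ι : Type*} (s : Finset ι) {f : ι → X → Measure Y} (hf : ∀ i ∈ s, IsKernelFun (f i)) :
    IsKernelFun fun a => ∑ i ∈ s, f i a := by
  classical
  induction s using Finset.induction_on with
  | empty => simpa using zero
  | insert i s hi ih =>
    simp only [Finset.sum_insert hi]
    exact (hf i (Finset.mem_insert_self i s)).add
      (ih fun j hj => hf j (Finset.mem_insert_of_mem hj))

/-- A parameter in a finite space is removed by writing `f` as a sum of its sections multiplied by
indicators. -/
lemma of_fintype {ι : Type*} [Fintype ι] [MeasurableSpace ι] [MeasurableSingletonClass ι]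
    {f : X × ι → Measure Y} (hf : ∀ i, IsKernelFun fun a => f (a, i)) : IsKernelFun f := by
  classical
  have h : f = fun p => ∑ i, (if p.2 = i then (1 : ENNReal) else 0) • f (p.1, i) := by
    funext p
    rw [Finset.sum_eq_single p.2 (fun i _ hi => by rw [if_neg hi.symm, zero_smul])
      (fun h => (h (Finset.mem_univ _)).elim), if_pos rfl, one_smul]
  rw [h]
  refine sum _ fun i _ => smul ((hf i).comp measurable_fst) ?_ fun p => by split_ifs <;> simp
  exact Measurable.ite (measurable_snd (measurableSet_singleton i)) measurable_const
    measurable_const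

lemma of_fintype_left {ι : Type*} [Fintype ι] [MeasurableSpace ι] [MeasurableSingletonClass ι]
    {f : ι × X → Measure Y} (hf : ∀ i, IsKernelFun fun a => f (i, a)) : IsKernelFun f :=
  (of_fintype (f := fun p : X × ι => f (p.2, p.1)) hf).comp measurable_swap

end IsKernelFun

end IsKernelFun

/-! ### The discrete laws of the algorithm -/

variable {N : ℕ}

lemma lintegral_categorical (p : Fin (N + 1) → ℝ) (f : Fin (N + 1) → ENNReal) :
    ∫⁻ i, f i ∂categorical p = ∑ i, ENNReal.ofReal (p i) * f i := by
  simp [categorical]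

lemma isProbabilityMeasure_categorical {p : Fin (N + 1) → ℝ} (hp : ∀ i, 0 ≤ p i)
    (hp1 : ∑ i, p i = 1) : IsProbabilityMeasure (categorical p) := by
  constructor
  rw [← lintegral_one, lintegral_categorical]
  simp only [mul_one]
  rw [← ENNReal.ofReal_sum_of_nonneg fun i _ => hp i, hp1, ENNReal.ofReal_one]

instance (p : Fin (N + 1) → ℝ) : IsFiniteMeasure (categorical p) := by
  constructor
  rw [← lintegral_one, lintegral_categorical]
  simp [ENNReal.sum_lt_top]

instance : IsProbabilityMeasure (uniformIndex N) := by
  refine isProbabilityMeasure_categorical (fun _ => by positivity) ?_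
  simp
  field_simp

lemma isKernelFun_categorical {X : Type*} [MeasurableSpace X] {p : X → Fin (N + 1) → ℝ}
    (hp : ∀ i, Measurable fun a => p a i) : IsKernelFun fun a => categorical (p a) :=
  IsKernelFun.sum _ fun i _ => (IsKernelFun.dirac measurable_const).smul
    (ENNReal.measurable_ofReal.comp (hp i)) fun _ => ENNReal.ofReal_ne_top

lemma measurable_normalize {X : Type*} [MeasurableSpace X] {p : X → Fin (N + 1) → ℝ}
    (hp : ∀ i, Measurable fun a => p a i) (i : Fin (N + 1)) :
    Measurable fun a => normalize (p a) i := by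
  unfold normalize
  fun_prop

/-- The probability of drawing the ancestor indices `a`. -/
noncomputable def ancestorProb (W : Fin (N + 1) → ℝ) (k' k : Fin (N + 1))
    (a : Fin (N + 1) → Fin (N + 1)) : ENNReal :=
  ∏ n, if n = k then (if a n = k' then 1 else 0) else ENNReal.ofReal (W (a n))

/-- The index space is finite, so the product measure is determined by its point masses, and the
ancestors can be handled by finite sums. -/
lemma ancestors_eq_sum (W : Fin (N + 1) → ℝ) (k' k : Fin (N + 1)) :
    ancestors W k' k = ∑ a, ancestorProb W k' k a • Measure.dirac a := by
  have : ∀ n, IsFiniteMeasure (if n = k then Measure.dirac k' else categorical W) := fun n => by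
    split_ifs <;> infer_instance
  refine Measure.ext_of_singleton fun a => ?_
  rw [ancestors, Measure.pi_singleton, Measure.finsetSum_apply]
  simp only [Measure.smul_apply, smul_eq_mul]
  rw [Finset.sum_eq_single a (fun b _ hb => by simp [hb]) (by simp)]
  simp only [ancestorProb, Measure.dirac_apply_of_mem (Set.mem_singleton a), mul_one]
  refine Finset.prod_congr rfl fun n _ => ?_
  split_ifs with h1 h2
  · simp [h2]
  · simp [Ne.symm h2]
  · rw [← lintegral_indicator_one (measurableSet_singleton _), lintegral_categorical,
      Finset.sum_eq_single (a n) (fun b _ hb => by simp [hb]) (by simp)]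
    simp

lemma lintegral_ancestors (W : Fin (N + 1) → ℝ) (k' k : Fin (N + 1))
    (f : (Fin (N + 1) → Fin (N + 1)) → ENNReal) :
    ∫⁻ a, f a ∂ancestors W k' k = ∑ a, ancestorProb W k' k a * f a := by
  simp [ancestors_eq_sum]

lemma isProbabilityMeasure_ancestors {W : Fin (N + 1) → ℝ} (hW : ∀ i, 0 ≤ W i)
    (hW1 : ∑ i, W i = 1) (k' k : Fin (N + 1)) : IsProbabilityMeasure (ancestors W k' k) := by
  have := isProbabilityMeasure_categorical hW hW1
  have : ∀ n, IsProbabilityMeasure (if n = k then Measure.dirac k' else categorical W) :=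
    fun n => by split_ifs <;> infer_instance
  unfold ancestors
  infer_instance

lemma isKernelFun_ancestors {X : Type*} [MeasurableSpace X] {W : X → Fin (N + 1) → ℝ}
    (hW : ∀ i, Measurable fun a => W a i) (k' k : Fin (N + 1)) :
    IsKernelFun fun a => ancestors (W a) k' k := by
  simp only [ancestors_eq_sum]
  refine IsKernelFun.sum _ fun a _ => (IsKernelFun.dirac measurable_const).smul ?_ fun b => ?_
  · refine Finset.measurable_fun_prod _ fun n _ => ?_
    split_ifs
    · exact measurable_const
    · exact measurable_const
    · exact ENNReal.measurable_ofReal.comp (hW _)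
  · refine ENNReal.prod_ne_top fun n _ => ?_
    split_ifs <;> simp

/-- Averaging the ancestors over the index of the reference particle's ancestor. -/
lemma sum_mul_ancestorProb (W : Fin (N + 1) → ℝ) (k : Fin (N + 1))
    (f : (Fin (N + 1) → Fin (N + 1)) → ENNReal) :
    ∑ k', ENNReal.ofReal (W k') * ∑ a, ancestorProb W k' k a * f a =
      ∑ a, (∏ n, ENNReal.ofReal (W (a n))) * f a := by
  simp only [Finset.mul_sum]
  rw [Finset.sum_comm]
  refine Finset.sum_congr rfl fun a _ => ?_
  -- Only `k' = a k` is compatible with `a`. Its weight `W (a k)` supplies the factor at `n = k`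
  -- that `ancestorProb` lacks, so the full product appears.
  rw [Finset.sum_eq_single (a k)]
  · rw [← mul_assoc, ancestorProb, ← Finset.mul_prod_erase _ _ (Finset.mem_univ k),
      ← Finset.mul_prod_erase _ (fun n => ENNReal.ofReal (W (a n))) (Finset.mem_univ k)]
    simp only [if_true, one_mul]
    congr 2
    refine Finset.prod_congr rfl fun n hn => ?_
    rw [if_neg (Finset.ne_of_mem_erase hn)]
  · intro b _ hb
    rw [ancestorProb, Finset.prod_eq_zero (Finset.mem_univ k) (by simp [hb.symm])]
    simp
  · simp

/-- Under the law of the ancestors, every particle's ancestor is distributed according to `W`. -/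
lemma sum_prod_mul_apply {W : Fin (N + 1) → ℝ} (hW : ∀ i, 0 ≤ W i) (hW1 : ∑ i, W i = 1)
    (k : Fin (N + 1)) (f : Fin (N + 1) → ENNReal) :
    ∑ a : Fin (N + 1) → Fin (N + 1), (∏ n, ENNReal.ofReal (W (a n))) * f (a k) =
      ∑ k', ENNReal.ofReal (W k') * f k' := by
  rw [← sum_mul_ancestorProb W k fun a => f (a k)]
  refine Finset.sum_congr rfl fun k' _ => ?_
  have := isProbabilityMeasure_ancestors hW hW1 k' k
  have h1 : ∑ a, ancestorProb W k' k a = 1 := by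
    have := lintegral_ancestors W k' k 1
    simpa using this.symm
  have h2 : ∀ a, ancestorProb W k' k a * f (a k) = ancestorProb W k' k a * f k' := by
    intro a
    by_cases h : a k = k'
    · rw [h]
    · rw [ancestorProb, Finset.prod_eq_zero (Finset.mem_univ k) (by simp [h])]
      simp
  simp only [h2]
  rw [← Finset.sum_mul, h1, one_mul]

end ParticlePCNL

namespace ParticlePCNL

/-- Strictly positive normalised weights. -/
structure IsWeight {N : ℕ} (W : Fin (N + 1) → ℝ) : Prop where
  pos : ∀ i, 0 < W i
  sum_eq_one : ∑ i, W i = 1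

variable {N : ℕ}

lemma isWeight_normalize {w : Fin (N + 1) → ℝ} (hw : ∀ i, 0 < w i) : IsWeight (normalize w) := by
  have h : 0 < ∑ i, w i := Finset.sum_pos (fun i _ => hw i) Finset.univ_nonempty
  refine ⟨fun i => div_pos (hw i) h, ?_⟩
  simp only [normalize]
  rw [← Finset.sum_div, div_self h.ne']

lemma ofReal_sum_mul_normalize {w : Fin (N + 1) → ℝ} (hw : ∀ i, 0 < w i) (i : Fin (N + 1)) :
    ENNReal.ofReal (∑ j, w j) * ENNReal.ofReal (normalize w i) = ENNReal.ofReal (w i) := by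
  have h : 0 < ∑ i, w i := Finset.sum_pos (fun i _ => hw i) Finset.univ_nonempty
  rw [← ENNReal.ofReal_mul h.le, normalize, mul_div_cancel₀ _ h.ne']

/-! ### The forced move -/

/-- The acceptance probability of the forced move. -/
noncomputable def acceptProb (W : Fin (N + 1) → ℝ) (k i : Fin (N + 1)) : ℝ :=
  min 1 ((1 - W k) / (1 - W i))

lemma lintegral_forcedMove (k : Fin (N + 1)) (W : Fin (N + 1) → ℝ) (f : Fin (N + 1) → ENNReal) :
    ∫⁻ i, f i ∂forcedMove k W = ∑ i ∈ Finset.univ.erase k, ENNReal.ofReal (W i / (1 - W k)) *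
      (ENNReal.ofReal (acceptProb W k i) * f i + ENNReal.ofReal (1 - acceptProb W k i) * f k) := by
  simp [forcedMove, acceptProb, mul_add]

namespace IsWeight

variable {W : Fin (N + 1) → ℝ}

lemma nonneg (hW : IsWeight W) (i : Fin (N + 1)) : 0 ≤ W i := (hW.pos i).le

/-- Here `N ≥ 1` enters: there is a second index, and it has positive weight. -/
lemma one_sub_pos (hN : 1 ≤ N) (hW : IsWeight W) (k : Fin (N + 1)) : 0 < 1 - W k := by
  have : Nontrivial (Fin (N + 1)) := Fin.nontrivial_iff_two_le.2 (by omega)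
  obtain ⟨j, hj⟩ := exists_ne k
  have := Finset.single_lt_sum hj (Finset.mem_univ k) (Finset.mem_univ j) (hW.pos j)
    (fun i _ _ => hW.nonneg i)
  rw [hW.sum_eq_one] at this
  linarith

lemma acceptProb_nonneg (hN : 1 ≤ N) (hW : IsWeight W) (k i : Fin (N + 1)) :
    0 ≤ acceptProb W k i :=
  le_min zero_le_one (div_nonneg (hW.one_sub_pos hN k).le (hW.one_sub_pos hN i).le)

lemma sum_erase (hN : 1 ≤ N) (hW : IsWeight W) (k : Fin (N + 1)) :
    ∑ i ∈ Finset.univ.erase k, ENNReal.ofReal (W i / (1 - W k)) = 1 := by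
  rw [← ENNReal.ofReal_sum_of_nonneg
    fun i _ => div_nonneg (hW.nonneg i) (hW.one_sub_pos hN k).le, ← Finset.sum_div,
    Finset.sum_erase_eq_sub (Finset.mem_univ k), hW.sum_eq_one,
    div_self (hW.one_sub_pos hN k).ne', ENNReal.ofReal_one]

lemma acceptProb_add (hN : 1 ≤ N) (hW : IsWeight W) (k i : Fin (N + 1)) :
    ENNReal.ofReal (acceptProb W k i) + ENNReal.ofReal (1 - acceptProb W k i) = 1 := by
  have h : acceptProb W k i ≤ 1 := min_le_left _ _
  rw [← ENNReal.ofReal_add (hW.acceptProb_nonneg hN k i) (sub_nonneg.2 h)]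
  simp

lemma isProbabilityMeasure_forcedMove (hN : 1 ≤ N) (hW : IsWeight W) (k : Fin (N + 1)) :
    IsProbabilityMeasure (forcedMove k W) := by
  constructor
  rw [← lintegral_one, lintegral_forcedMove]
  simp only [mul_one, hW.acceptProb_add hN, hW.sum_erase hN]

/-- Both sides equal `W k * W i * min (1 - W k) (1 - W i) / ((1 - W k) * (1 - W i))`, which is
symmetric in `k` and `i`. -/
lemma detailed_balance (hN : 1 ≤ N) (hW : IsWeight W) (k i : Fin (N + 1)) :
    W k * (W i / (1 - W k) * acceptProb W k i) = W i * (W k / (1 - W i) * acceptProb W i k) := by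
  have hk := hW.one_sub_pos hN k
  have hi := hW.one_sub_pos hN i
  have h : ∀ a b : ℝ, 0 < a → 0 < b → min 1 (a / b) = min a b / b := fun a b _ hb => by
    rw [show (1 : ℝ) = b / b from (div_self hb.ne').symm, min_div_div_right hb.le, min_comm]
  unfold acceptProb
  rw [h _ _ hk hi, h _ _ hi hk, min_comm (1 - W i)]
  field_simp

/-- The forced move leaves the law given by the weights invariant. -/
theorem sum_mul_lintegral_forcedMove (hN : 1 ≤ N) (hW : IsWeight W) (f : Fin (N + 1) → ENNReal) :
    ∑ k, ENNReal.ofReal (W k) * ∫⁻ i, f i ∂forcedMove k W = ∑ k, ENNReal.ofReal (W k) * f k := by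
  have hsymm : ∀ k i, ENNReal.ofReal (W k) * (ENNReal.ofReal (W i / (1 - W k)) *
      ENNReal.ofReal (acceptProb W k i)) = ENNReal.ofReal (W i) *
      (ENNReal.ofReal (W k / (1 - W i)) * ENNReal.ofReal (acceptProb W i k)) := fun k i => by
    rw [← ENNReal.ofReal_mul (div_nonneg (hW.nonneg i) (hW.one_sub_pos hN k).le),
      ← ENNReal.ofReal_mul (hW.nonneg k), hW.detailed_balance hN, ENNReal.ofReal_mul (hW.nonneg i),
      ENNReal.ofReal_mul (div_nonneg (hW.nonneg k) (hW.one_sub_pos hN i).le)]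
  -- By detailed balance, exchanging the names of `k` and `i` in the accepted part replaces `f i` by
  -- `f k`. Acceptance and rejection then recombine to probability one.
  have hswap : ∑ k, ∑ i ∈ Finset.univ.erase k, ENNReal.ofReal (W k) *
      (ENNReal.ofReal (W i / (1 - W k)) * ENNReal.ofReal (acceptProb W k i)) * f i =
      ∑ k, ∑ i ∈ Finset.univ.erase k, ENNReal.ofReal (W k) *
      (ENNReal.ofReal (W i / (1 - W k)) * ENNReal.ofReal (acceptProb W k i)) * f k := by
    rw [Finset.sum_comm' (t' := Finset.univ) (s' := fun i => Finset.univ.erase i)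
      (by simp [eq_comm])]
    refine Finset.sum_congr rfl fun k _ => Finset.sum_congr rfl fun i _ => ?_
    rw [hsymm]
  have hsplit : ∀ k, ENNReal.ofReal (W k) * ∫⁻ i, f i ∂forcedMove k W =
      ∑ i ∈ Finset.univ.erase k, ENNReal.ofReal (W k) *
      (ENNReal.ofReal (W i / (1 - W k)) * ENNReal.ofReal (acceptProb W k i)) * f i +
      ∑ i ∈ Finset.univ.erase k, ENNReal.ofReal (W k) *
      (ENNReal.ofReal (W i / (1 - W k)) * ENNReal.ofReal (1 - acceptProb W k i)) * f k := by
    intro k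
    rw [lintegral_forcedMove, Finset.mul_sum, ← Finset.sum_add_distrib]
    refine Finset.sum_congr rfl fun i _ => ?_
    ring
  simp only [hsplit]
  rw [Finset.sum_add_distrib, hswap, ← Finset.sum_add_distrib]
  refine Finset.sum_congr rfl fun k _ => ?_
  rw [← Finset.sum_add_distrib]
  calc _ = ∑ i ∈ Finset.univ.erase k, ENNReal.ofReal (W i / (1 - W k)) *
        (ENNReal.ofReal (W k) * f k) := by
        refine Finset.sum_congr rfl fun i _ => ?_
        rw [← add_mul, ← mul_add, ← mul_add, hW.acceptProb_add hN]
        ring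
    _ = _ := by rw [← Finset.sum_mul, hW.sum_erase hN, one_mul]

end IsWeight

lemma isKernelFun_forcedMove {X : Type*} [MeasurableSpace X] {W : X → Fin (N + 1) → ℝ}
    (hW : ∀ i, Measurable fun a => W a i) (k : Fin (N + 1)) :
    IsKernelFun fun a => forcedMove k (W a) := by
  refine IsKernelFun.sum _ fun i _ => IsKernelFun.smul (IsKernelFun.add
    (IsKernelFun.smul (IsKernelFun.dirac measurable_const) ?_ fun _ => ENNReal.ofReal_ne_top)
    (IsKernelFun.smul (IsKernelFun.dirac measurable_const) ?_ fun _ => ENNReal.ofReal_ne_top)) ?_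
    fun _ => ENNReal.ofReal_ne_top
  all_goals fun_prop

end ParticlePCNL

namespace ParticlePCNL

variable {D N : ℕ}

/-! ### Regular schemes -/

/-- A scheme whose proposals are probability kernels and whose weights are positive, such that the
weight of the reference particle is the joint density of the particles under `Q` and the proposal. -/
structure Scheme.Regular (A : Scheme D N) : Prop where
  measurable_Q : ∀ t, Measurable fun p : State D × State D => A.Q t p.1 p.2
  Q_pos : ∀ t x' x, 0 < A.Q t x' x
  isProbabilityMeasure_propose : ∀ t prev k x, IsProbabilityMeasure (A.propose t prev k x)
  measurable_propose : ∀ t k, Measurable fun p : Particles D N × State D => A.propose t p.1 k p.2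
  measurable_weight : ∀ t n, Measurable fun p : Particles D N × Particles D N => A.weight t p.1 p.2 n
  weight_pos : ∀ t prev z n, 0 < A.weight t prev z n
  lintegral_propose : ∀ t prev k (f : State D × Particles D N → ENNReal), Measurable f →
    ∫⁻ x, ENNReal.ofReal (A.Q t (prev k) x) * ∫⁻ z, f (x, z) ∂A.propose t prev k x =
      ∫⁻ z, ENNReal.ofReal (A.weight t prev z k) * f (z k, z)

namespace Scheme

variable {A : Scheme D N}

lemma Regular.isKernelFun_populate (hA : A.Regular) (t : ℕ) (k : Fin (N + 1)) :
    IsKernelFun fun p : Particles D N × State D => A.populate t p.1 k p.2 := by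
  have h := IsKernelFun.of_isProbabilityMeasure (hA.measurable_propose t k)
    fun p => hA.isProbabilityMeasure_propose t p.1 k p.2
  refine h.map (g := fun q : (Particles D N × State D) × Particles D N =>
    (k, q.2, normalize (A.weight t q.1.1 q.2))) ?_
  refine measurable_const.prodMk (measurable_snd.prodMk (measurable_pi_lambda _ fun i => ?_))
  exact measurable_normalize (fun i => (hA.measurable_weight t i).comp (by fun_prop :
    Measurable fun q : (Particles D N × State D) × Particles D N => (q.1.1, q.2))) i

lemma Regular.isKernelFun_initial (hA : A.Regular) :
    IsKernelFun fun x : State D => A.initial x :=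
  IsKernelFun.bind (f := fun _ => uniformIndex N)
    (g := fun p : State D × Fin (N + 1) => A.populate 1 (fun _ => 0) p.2 p.1)
    (isKernelFun_categorical fun _ => measurable_const)
    (IsKernelFun.of_fintype fun k => (hA.isKernelFun_populate 1 k).comp
      (g := fun x : State D => ((fun _ => 0 : Particles D N), x)) (by fun_prop))

lemma Regular.isKernelFun_step (hA : A.Regular) (t : ℕ) :
    IsKernelFun fun p : Slice D N × State D => A.step t p.1 p.2 := by
  refine IsKernelFun.bind (f := fun _ => uniformIndex N)
    (g := fun p : (Slice D N × State D) × Fin (N + 1) =>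
      (ancestors p.1.1.2.2 p.1.1.1 p.2).bind fun a =>
        A.populate (t + 1) (fun n => p.1.1.2.1 (a n)) p.2 p.1.2)
    (isKernelFun_categorical fun _ => measurable_const)
    (IsKernelFun.of_fintype fun k => ?_)
  refine IsKernelFun.bind
    (g := fun q : (Slice D N × State D) × (Fin (N + 1) → Fin (N + 1)) =>
      A.populate (t + 1) (fun n => q.1.1.2.1 (q.2 n)) k q.1.2) ?_
    (IsKernelFun.of_fintype fun a => (hA.isKernelFun_populate (t + 1) k).comp
      (g := fun p : Slice D N × State D => ((fun n => p.1.2.1 (a n) : Particles D N), p.2))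
      (by fun_prop))
  have h : IsKernelFun fun q : Fin (N + 1) × (Fin (N + 1) → ℝ) => ancestors q.2 q.1 k :=
    IsKernelFun.of_fintype_left fun k' => isKernelFun_ancestors (fun i => by fun_prop) k' k
  exact h.comp (g := fun p : Slice D N × State D => (p.1.1, p.1.2.2)) (by fun_prop)

lemma measurable_cons {r : ℕ} {X : Type*} [MeasurableSpace X] {f : X → State D}
    {g : X → Fin r → State D} (hf : Measurable f) (hg : Measurable g) :
    Measurable fun a => (Fin.cons (f a) (g a) : Fin (r + 1) → State D) := by
  refine measurable_pi_lambda _ fun i => ?_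
  refine Fin.cases ?_ (fun j => ?_) i
  · simpa using hf
  · simpa [Function.comp_def] using (measurable_pi_apply j).comp hg

lemma measurable_tail {r : ℕ} : Measurable (Fin.tail : (Fin (r + 1) → State D) → Fin r → State D) :=
  measurable_pi_lambda _ fun _ => measurable_pi_apply _

lemma Regular.isKernelFun_backward (hA : A.Regular) (t r : ℕ) :
    IsKernelFun fun p : Slice D N × (Fin (r + 1) → State D) =>
      (A.backward t p.1 (p.2 0)).map fun l =>
        (Fin.cons (p.1.2.1 l) p.2 : Fin (r + 2) → State D) := by
  refine IsKernelFun.map (g := fun q : (Slice D N × (Fin (r + 1) → State D)) × Fin (N + 1) =>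
    (Fin.cons (q.1.1.2.1 q.2) q.1.2 : Fin (r + 2) → State D))
    (isKernelFun_categorical fun i => ?_) ?_
  · refine measurable_normalize (fun i => ?_) i
    refine Measurable.mul (by fun_prop) ?_
    exact (hA.measurable_Q (t + 1)).comp (by fun_prop :
      Measurable fun p : Slice D N × (Fin (r + 1) → State D) => (p.1.2.1 i, p.2 0))
  · exact measurable_from_prod_countable_left fun l => measurable_cons
      (by dsimp only; fun_prop) measurable_snd

lemma Regular.isKernelFun_run (hA : A.Regular) (r : ℕ) : ∀ t,
    IsKernelFun fun p : Slice D N × (Fin r → State D) => A.run r t p.1 p.2 := by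
  induction r with
  | zero =>
    intro t
    simp only [run]
    refine IsKernelFun.map (g := fun q : (Slice D N × (Fin 0 → State D)) × Fin (N + 1) =>
      fun _ : Fin 1 => q.1.1.2.1 q.2) ?_ ?_
    · have h : IsKernelFun fun q : Fin (N + 1) × (Fin (N + 1) → ℝ) => forcedMove q.1 q.2 :=
        IsKernelFun.of_fintype_left fun k => isKernelFun_forcedMove (fun i => by fun_prop) k
      exact h.comp (g := fun p : Slice D N × (Fin 0 → State D) => (p.1.1, p.1.2.2)) (by fun_prop)
    · exact measurable_from_prod_countable_left fun l => by dsimp only; fun_prop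
  | succ r ih =>
    intro t
    simp only [run]
    refine IsKernelFun.bind (g := fun q : (Slice D N × (Fin (r + 1) → State D)) × Slice D N =>
      (A.run r (t + 1) q.2 (Fin.tail q.1.2)).bind fun y =>
        (A.backward t q.1.1 (y 0)).map fun l =>
          (Fin.cons (q.1.1.2.1 l) y : Fin (r + 2) → State D))
      ((hA.isKernelFun_step t).comp (g := fun p : Slice D N × (Fin (r + 1) → State D) =>
        (p.1, p.2 0)) (by fun_prop)) ?_
    have hr := (ih (t + 1)).comp
      (g := fun q : (Slice D N × (Fin (r + 1) → State D)) × Slice D N => (q.2, Fin.tail q.1.2))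
      (measurable_snd.prodMk (measurable_tail.comp (by fun_prop)))
    have hb := (hA.isKernelFun_backward t r).comp
      (g := fun q : ((Slice D N × (Fin (r + 1) → State D)) × Slice D N) × (Fin (r + 1) → State D) =>
        (q.1.1.1, q.2)) (by fun_prop)
    exact IsKernelFun.bind
      (g := fun p : ((Slice D N × (Fin (r + 1) → State D)) × Slice D N) × (Fin (r + 1) → State D) =>
        (A.backward t p.1.1.1 (p.2 0)).map fun l =>
          (Fin.cons (p.1.1.1.2.1 l) p.2 : Fin (r + 2) → State D)) hr hb

lemma Regular.isKernelFun_law (hA : A.Regular) (S : ℕ) :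
    IsKernelFun fun x : Fin (S + 1) → State D => A.law S x :=
  IsKernelFun.bind (g := fun p : (Fin (S + 1) → State D) × Slice D N =>
      A.run S 1 p.2 (Fin.tail p.1))
    (hA.isKernelFun_initial.comp (g := fun x : Fin (S + 1) → State D => x 0) (by fun_prop))
    ((hA.isKernelFun_run S 1).comp (g := fun p : (Fin (S + 1) → State D) × Slice D N =>
      (p.2, Fin.tail p.1)) (measurable_snd.prodMk (measurable_tail.comp measurable_fst)))

/-! ### Integrals against the laws of the algorithm -/

lemma Regular.lintegral_populate (hA : A.Regular) (t : ℕ) (prev : Particles D N) (k : Fin (N + 1))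
    (x : State D) {f : Slice D N → ENNReal} (hf : Measurable f) :
    ∫⁻ s, f s ∂A.populate t prev k x =
      ∫⁻ z, f (k, z, normalize (A.weight t prev z)) ∂A.propose t prev k x := by
  refine lintegral_map hf ?_
  refine measurable_const.prodMk (measurable_id.prodMk (measurable_pi_lambda _ fun i => ?_))
  exact measurable_normalize (fun i => (hA.measurable_weight t i).comp measurable_prodMk_left) i

lemma lintegral_uniformIndex (f : Fin (N + 1) → ENNReal) :
    ∫⁻ k, f k ∂uniformIndex N = ∑ k, ENNReal.ofReal (1 / ((N : ℝ) + 1)) * f k :=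
  lintegral_categorical _ _

lemma lintegral_step (t : ℕ) (s : Slice D N) (x : State D)
    {f : Slice D N → ENNReal} (hf : Measurable f) :
    ∫⁻ s', f s' ∂A.step t s x = ∑ k, ENNReal.ofReal (1 / ((N : ℝ) + 1)) *
      ∑ a, ancestorProb s.2.2 s.1 k a *
        ∫⁻ s', f s' ∂A.populate (t + 1) (fun n => s.2.1 (a n)) k x := by
  unfold step
  rw [Measure.lintegral_bind (measurable_of_countable _).aemeasurable hf.aemeasurable,
    lintegral_uniformIndex]
  refine Finset.sum_congr rfl fun k _ => ?_
  rw [Measure.lintegral_bind (measurable_of_countable _).aemeasurable hf.aemeasurable,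
    lintegral_ancestors]

lemma Regular.lintegral_run_succ (hA : A.Regular) (r t : ℕ) (s : Slice D N)
    (x : Fin (r + 1) → State D) {f : (Fin (r + 2) → State D) → ENNReal} (hf : Measurable f) :
    ∫⁻ y, f y ∂A.run (r + 1) t s x = ∫⁻ s', ∫⁻ y, ∑ l, ENNReal.ofReal
      (normalize (fun i => s.2.2 i * A.Q (t + 1) (s.2.1 i) (y 0)) l) * f (Fin.cons (s.2.1 l) y)
        ∂A.run r (t + 1) s' (Fin.tail x) ∂A.step t s (x 0) := by
  have hb : Measurable fun y : Fin (r + 1) → State D => (A.backward t s (y 0)).map fun l =>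
      (Fin.cons (s.2.1 l) y : Fin (r + 2) → State D) :=
    (hA.isKernelFun_backward t r).measurable.comp measurable_prodMk_left
  have hr : IsKernelFun fun s' => A.run r (t + 1) s' (Fin.tail x) :=
    (hA.isKernelFun_run r (t + 1)).comp (g := fun s' : Slice D N => (s', Fin.tail x))
      measurable_prodMk_right
  have hrb : IsKernelFun fun s' => (A.run r (t + 1) s' (Fin.tail x)).bind fun y =>
      (A.backward t s (y 0)).map fun l => (Fin.cons (s.2.1 l) y : Fin (r + 2) → State D) :=
    hr.bind (g := fun p : Slice D N × (Fin (r + 1) → State D) =>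
      (A.backward t s (p.2 0)).map fun l => (Fin.cons (s.2.1 l) p.2 : Fin (r + 2) → State D))
      ((hA.isKernelFun_backward t r).comp (g := fun p : Slice D N × (Fin (r + 1) → State D) =>
        (s, p.2)) (by fun_prop))
  rw [run, Measure.lintegral_bind hrb.measurable.aemeasurable hf.aemeasurable]
  refine lintegral_congr fun s' => ?_
  rw [Measure.lintegral_bind hb.aemeasurable hf.aemeasurable]
  refine lintegral_congr fun y => ?_
  rw [lintegral_map hf (measurable_of_countable _), backward, lintegral_categorical]

lemma Regular.lintegral_law (hA : A.Regular) (S : ℕ) (x : Fin (S + 1) → State D)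
    {f : (Fin (S + 1) → State D) → ENNReal} (hf : Measurable f) :
    ∫⁻ y, f y ∂A.law S x = ∑ k, ENNReal.ofReal (1 / ((N : ℝ) + 1)) *
      ∫⁻ s, ∫⁻ y, f y ∂A.run S 1 s (Fin.tail x) ∂A.populate 1 (fun _ => 0) k (x 0) := by
  have hr : Measurable fun s => A.run S 1 s (Fin.tail x) :=
    (hA.isKernelFun_run S 1).measurable.comp measurable_prodMk_right
  have hfr : Measurable fun s => ∫⁻ y, f y ∂A.run S 1 s (Fin.tail x) :=
    (Measure.measurable_lintegral hf).comp hr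
  unfold law
  rw [Measure.lintegral_bind hr.aemeasurable hf.aemeasurable, initial,
    Measure.lintegral_bind (measurable_of_countable _).aemeasurable hfr.aemeasurable,
    lintegral_uniformIndex]

end Scheme
end ParticlePCNL

namespace ParticlePCNL

variable {D N : ℕ}

/-! ### Path densities -/

/-- `∏_{i < r} Q_{t+i}(x_{i-1}, x_i)` with `x_{-1} = x'`. -/
noncomputable def pathDensity (Q : ℕ → State D → State D → ℝ) :
    (r : ℕ) → ℕ → State D → (Fin r → State D) → ENNReal
  | 0, _, _, _ => 1
  | r + 1, t, x', x => ENNReal.ofReal (Q t x' (x 0)) * pathDensity Q r (t + 1) (x 0) (Fin.tail x)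

lemma pathDensity_cons (Q : ℕ → State D → State D → ℝ) (r t : ℕ) (x' a : State D)
    (y : Fin r → State D) : pathDensity Q (r + 1) t x' (Fin.cons a y) =
      ENNReal.ofReal (Q t x' a) * pathDensity Q r (t + 1) a y := by
  simp [pathDensity]

lemma measurable_pathDensity {Q : ℕ → State D → State D → ℝ}
    (hQ : ∀ t, Measurable fun p : State D × State D => Q t p.1 p.2) (r : ℕ) :
    ∀ t, Measurable fun p : State D × (Fin r → State D) => pathDensity Q r t p.1 p.2 := by
  induction r with
  | zero => intro t; simp only [pathDensity]; exact measurable_const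
  | succ r ih =>
    intro t
    simp only [pathDensity]
    refine (ENNReal.measurable_ofReal.comp ((hQ t).comp (by fun_prop :
      Measurable fun p : State D × (Fin (r + 1) → State D) => (p.1, p.2 0)))).mul ?_
    exact (ih (t + 1)).comp (f := fun p : State D × (Fin (r + 1) → State D) => (p.2 0, Fin.tail p.2))
      ((by fun_prop : Measurable fun p : State D × (Fin (r + 1) → State D) => p.2 0).prodMk
        (Scheme.measurable_tail.comp measurable_snd))

lemma measurable_pathDensity_right {Q : ℕ → State D → State D → ℝ}
    (hQ : ∀ t, Measurable fun p : State D × State D => Q t p.1 p.2) (r t : ℕ) (x' : State D) :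
    Measurable (pathDensity Q r t x') :=
  (measurable_pathDensity hQ r t).comp (f := fun x => (x', x)) measurable_prodMk_left

/-- Connects the recursive density used in the induction with the product in `pathWeight`, which is
the case `t = 1`, `x' = 0`. -/
lemma pathDensity_eq_ofReal_prod {Q : ℕ → State D → State D → ℝ} (hQ : ∀ t x' x, 0 ≤ Q t x' x)
    (r : ℕ) : ∀ t (x' : State D) (x : Fin r → State D), pathDensity Q r t x' x =
      ENNReal.ofReal (∏ i : Fin r,
        Q (i + t) ((Fin.cons x' x : Fin (r + 1) → State D) i.castSucc) (x i)) := by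
  induction r with
  | zero => intro t x' x; simp [pathDensity]
  | succ r ih =>
    intro t x' x
    rw [pathDensity, ih, Fin.prod_univ_succ, ENNReal.ofReal_mul (hQ _ _ _)]
    congr 2
    · simp
    · refine Finset.prod_congr rfl fun i _ => ?_
      rw [Fin.cons_self_tail, ← Fin.succ_castSucc, Fin.cons_succ, Fin.val_succ,
        Nat.add_right_comm, Nat.add_assoc]
      rfl

lemma lintegral_cons {r : ℕ} {f : (Fin (r + 1) → State D) → ENNReal} (hf : Measurable f) :
    ∫⁻ x, f x = ∫⁻ a : State D, ∫⁻ y : Fin r → State D, f (Fin.cons a y) := by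
  rw [lintegral_insertNth 0 f hf]
  simp only [Fin.insertNth_zero']

namespace Scheme

variable {A : Scheme D N}

/-! ### Total mass -/

/-- The values of `f` matter only on slices with strictly positive normalised weights, since
`populate` produces no others. -/
lemma Regular.lintegral_populate_eq_one (hA : A.Regular) (t : ℕ) (prev : Particles D N)
    (k : Fin (N + 1)) (x : State D) {f : Slice D N → ENNReal} (hf : Measurable f)
    (hf1 : ∀ s, IsWeight s.2.2 → f s = 1) : ∫⁻ s, f s ∂A.populate t prev k x = 1 := by
  have := hA.isProbabilityMeasure_propose t prev k x
  rw [hA.lintegral_populate t prev k x hf]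
  have h : ∀ z, f (k, z, normalize (A.weight t prev z)) = 1 := fun z =>
    hf1 _ (isWeight_normalize (hA.weight_pos t prev z))
  simp [h]

lemma sum_uniform : ∑ _k : Fin (N + 1), ENNReal.ofReal (1 / ((N : ℝ) + 1)) = 1 := by
  have h := lintegral_uniformIndex (N := N) 1
  simpa using h.symm

lemma sum_ancestorProb {W : Fin (N + 1) → ℝ} (hW : IsWeight W) (k' k : Fin (N + 1)) :
    ∑ a, ancestorProb W k' k a = 1 := by
  have := isProbabilityMeasure_ancestors hW.nonneg hW.sum_eq_one k' k
  simpa using (lintegral_ancestors W k' k 1).symm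

lemma Regular.backward_pos (hA : A.Regular) (t : ℕ) {z : Particles D N} {W : Fin (N + 1) → ℝ}
    (hW : IsWeight W) (x : State D) (i : Fin (N + 1)) : 0 < W i * A.Q (t + 1) (z i) x :=
  mul_pos (hW.pos i) (hA.Q_pos _ _ _)

lemma Regular.measurable_lintegral_run (hA : A.Regular) (r t : ℕ)
    {f : (Fin (r + 1) → State D) → ENNReal} (hf : Measurable f) :
    Measurable fun p : Slice D N × (Fin r → State D) => ∫⁻ y, f y ∂A.run r t p.1 p.2 :=
  (Measure.measurable_lintegral hf).comp (hA.isKernelFun_run r t).measurable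

/-- The restriction on `s` is needed for the forced move and for the ancestors to be probabilities.
It propagates through the induction because every later slice comes from `populate`. -/
lemma Regular.lintegral_one_run (hA : A.Regular) (hN : 1 ≤ N) (r : ℕ) :
    ∀ t (s : Slice D N) (x : Fin r → State D), IsWeight s.2.2 → ∫⁻ _, 1 ∂A.run r t s x = 1 := by
  induction r with
  | zero =>
    intro t s x hs
    have := hs.isProbabilityMeasure_forcedMove hN s.1
    rw [run, lintegral_map measurable_const (measurable_of_countable _)]
    simp
  | succ r ih =>
    intro t s x hs
    rw [hA.lintegral_run_succ r t s x measurable_const]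
    have h1 : ∀ y : Fin (r + 1) → State D, ∑ l, ENNReal.ofReal
        (normalize (fun i => s.2.2 i * A.Q (t + 1) (s.2.1 i) (y 0)) l) * 1 = 1 := by
      intro y
      have hw := isWeight_normalize (hA.backward_pos t (z := s.2.1) hs (y 0))
      simp only [mul_one]
      rw [← ENNReal.ofReal_sum_of_nonneg fun i _ => hw.nonneg i, hw.sum_eq_one, ENNReal.ofReal_one]
    simp only [h1]
    have hm : Measurable fun s' => ∫⁻ _, 1 ∂A.run r (t + 1) s' (Fin.tail x) :=
      (hA.measurable_lintegral_run r (t + 1) measurable_const).comp measurable_prodMk_right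
    rw [lintegral_step t s (x 0) hm]
    simp only [hA.lintegral_populate_eq_one _ _ _ _ hm fun s' hs' => ih _ _ _ hs', mul_one,
      sum_ancestorProb hs, sum_uniform]

lemma Regular.isProbabilityMeasure_law (hA : A.Regular) (hN : 1 ≤ N) (S : ℕ)
    (x : Fin (S + 1) → State D) : IsProbabilityMeasure (A.law S x) := by
  constructor
  rw [← lintegral_one, hA.lintegral_law S x measurable_const]
  have hm : Measurable fun s => ∫⁻ _, 1 ∂A.run S 1 s (Fin.tail x) :=
    (hA.measurable_lintegral_run S 1 measurable_const).comp measurable_prodMk_right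
  simp only [hA.lintegral_populate_eq_one _ _ _ _ hm fun s' hs' => hA.lintegral_one_run hN _ _ _ _ hs',
    mul_one, sum_uniform]

/-! ### Invariance -/

/-- The identity behind the induction over time: if the remaining times leave their conditional
target invariant, so do the generation of the particles at time `t` and the remaining times. -/
lemma Regular.sum_lintegral_populate (hA : A.Regular) (r t : ℕ) (prev : Particles D N)
    {f : (Fin (r + 1) → State D) → ENNReal} (hf : Measurable f)
    (ih : ∀ (z : Particles D N) (W : Fin (N + 1) → ℝ), IsWeight W →
      ∑ k, ENNReal.ofReal (W k) * ∫⁻ x, pathDensity A.Q r (t + 1) (z k) x *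
        ∫⁻ y, f y ∂A.run r t (k, z, W) x =
      ∑ k, ENNReal.ofReal (W k) * ∫⁻ x, pathDensity A.Q r (t + 1) (z k) x * f (Fin.cons (z k) x)) :
    ∑ k, ∫⁻ x, pathDensity A.Q (r + 1) t (prev k) x *
      ∫⁻ s, ∫⁻ y, f y ∂A.run r t s (Fin.tail x) ∂A.populate t prev k (x 0) =
    ∑ k, ∫⁻ x, pathDensity A.Q (r + 1) t (prev k) x * f x := by
  have hpd := measurable_pathDensity hA.measurable_Q r (t + 1)
  have hpd' : ∀ k, Measurable fun x => pathDensity A.Q (r + 1) t (prev k) x := fun k =>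
    (measurable_pathDensity hA.measurable_Q (r + 1) t).comp measurable_prodMk_left
  have hR := hA.measurable_lintegral_run r t hf
  have hslice : ∀ k : Fin (N + 1), Measurable fun z : Particles D N =>
      ((k, z, normalize (A.weight t prev z)) : Slice D N) := fun k =>
    measurable_const.prodMk (measurable_id.prodMk (measurable_pi_lambda _ fun i =>
      measurable_normalize (fun i => (hA.measurable_weight t i).comp measurable_prodMk_left) i))
  have hw : ∀ k, Measurable fun z => ENNReal.ofReal (A.weight t prev z k) := fun k =>
    ENNReal.measurable_ofReal.comp ((hA.measurable_weight t k).comp measurable_prodMk_left)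
  -- the integral over the later reference states, given the system at time `t`
  set Φ : Fin (N + 1) → State D × Particles D N → ENNReal := fun k p =>
    ∫⁻ x, pathDensity A.Q r (t + 1) p.1 x *
      ∫⁻ y, f y ∂A.run r t (k, p.2, normalize (A.weight t prev p.2)) x with hΦ
  set Ψ : State D → ENNReal := fun a =>
    ∫⁻ x, pathDensity A.Q r (t + 1) a x * f (Fin.cons a x) with hΨ
  have hΦm' : ∀ k, Measurable fun q : (State D × Particles D N) × (Fin r → State D) =>
      pathDensity A.Q r (t + 1) q.1.1 q.2 *
        ∫⁻ y, f y ∂A.run r t (k, q.1.2, normalize (A.weight t prev q.1.2)) q.2 := fun k =>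
    (hpd.comp (f := fun q : (State D × Particles D N) × (Fin r → State D) => (q.1.1, q.2))
      (by fun_prop)).mul
    (hR.comp (f := fun q : (State D × Particles D N) × (Fin r → State D) =>
      (((k, q.1.2, normalize (A.weight t prev q.1.2)) : Slice D N), q.2))
      (((hslice k).comp (measurable_snd.comp measurable_fst)).prodMk measurable_snd))
  have hΦm : ∀ k, Measurable (Φ k) := fun k => (hΦm' k).lintegral_prod_right'
  have hΨm' : Measurable fun q : State D × (Fin r → State D) =>
      pathDensity A.Q r (t + 1) q.1 q.2 * f (Fin.cons q.1 q.2) :=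
    hpd.mul (hf.comp (measurable_cons measurable_fst measurable_snd))
  have hΨm : Measurable Ψ := hΨm'.lintegral_prod_right'
  -- The proposal integral is moved outside the integral over later states, so that the density
  -- identity can absorb the first factor of the path density and the proposal into the weight
  -- `w^k`.
  have hleft : ∀ k, ∫⁻ x, pathDensity A.Q (r + 1) t (prev k) x *
      ∫⁻ s, ∫⁻ y, f y ∂A.run r t s (Fin.tail x) ∂A.populate t prev k (x 0) =
      ∫⁻ z, ENNReal.ofReal (A.weight t prev z k) * Φ k (z k, z) := by
    intro k
    rw [← hA.lintegral_propose t prev k (Φ k) (hΦm k), lintegral_cons]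
    · refine lintegral_congr fun a => ?_
      have := hA.isProbabilityMeasure_propose t prev k a
      simp only [Fin.cons_zero, Fin.tail_cons, pathDensity_cons, mul_assoc]
      have hin : ∀ y : Fin r → State D,
          ∫⁻ s, ∫⁻ y', f y' ∂A.run r t s y ∂A.populate t prev k a =
          ∫⁻ z, ∫⁻ y', f y' ∂A.run r t (k, z, normalize (A.weight t prev z)) y
            ∂A.propose t prev k a := fun y =>
        hA.lintegral_populate t prev k a (hR.comp measurable_prodMk_right)
      have hRz : Measurable fun q : (Fin r → State D) × Particles D N =>
          ∫⁻ y', f y' ∂A.run r t (k, q.2, normalize (A.weight t prev q.2)) q.1 :=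
        hR.comp (f := fun q : (Fin r → State D) × Particles D N =>
          (((k, q.2, normalize (A.weight t prev q.2)) : Slice D N), q.1))
          (((hslice k).comp measurable_snd).prodMk measurable_fst)
      have hpa : Measurable fun y => pathDensity A.Q r (t + 1) a y :=
        hpd.comp measurable_prodMk_left
      simp only [hin]
      refine (lintegral_const_mul _ (hpa.mul hRz.lintegral_prod_right')).trans ?_
      congr 1
      have hpull : ∀ y, pathDensity A.Q r (t + 1) a y *
          ∫⁻ z, ∫⁻ y', f y' ∂A.run r t (k, z, normalize (A.weight t prev z)) y
            ∂A.propose t prev k a = ∫⁻ z, pathDensity A.Q r (t + 1) a y *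
            ∫⁻ y', f y' ∂A.run r t (k, z, normalize (A.weight t prev z)) y
            ∂A.propose t prev k a := fun y =>
        (lintegral_const_mul _ (hRz.comp measurable_prodMk_left)).symm
      refine (lintegral_congr hpull).trans ?_
      exact lintegral_lintegral_swap (f := fun y z => pathDensity A.Q r (t + 1) a y *
            ∫⁻ y', f y' ∂A.run r t (k, z, normalize (A.weight t prev z)) y)
        ((hpa.comp measurable_fst).mul hRz).aemeasurable
    · refine (hpd' k).mul (IsKernelFun.measurable_lintegral
        (f := fun x : Fin (r + 1) → State D => A.populate t prev k (x 0))
        (g := fun p : (Fin (r + 1) → State D) × Slice D N =>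
          ∫⁻ y, f y ∂A.run r t p.2 (Fin.tail p.1)) ?_ ?_)
      · exact (hA.isKernelFun_populate t k).comp
          (g := fun x : Fin (r + 1) → State D => (prev, x 0)) (by fun_prop)
      · exact hR.comp (f := fun p : (Fin (r + 1) → State D) × Slice D N => (p.2, Fin.tail p.1))
          (measurable_snd.prodMk (measurable_tail.comp measurable_fst))
  have hright : ∀ k, ∫⁻ x, pathDensity A.Q (r + 1) t (prev k) x * f x =
      ∫⁻ z, ENNReal.ofReal (A.weight t prev z k) * Ψ (z k) := by
    intro k
    -- The same identity is applied to a function that ignores the particles; the proposal then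
    -- contributes only its total mass one.
    rw [← hA.lintegral_propose t prev k (fun p => Ψ p.1) (hΨm.comp measurable_fst)]
    refine (lintegral_cons ((hpd' k).mul hf)).trans ?_
    refine lintegral_congr fun a => ?_
    have := hA.isProbabilityMeasure_propose t prev k a
    simp only [Pi.mul_apply, pathDensity_cons, mul_assoc, lintegral_const, measure_univ, mul_one]
    exact lintegral_const_mul _ (hΨm'.comp measurable_prodMk_left)
  simp only [hleft, hright]
  have hl : ∀ k, Measurable fun z : Particles D N =>
      ENNReal.ofReal (A.weight t prev z k) * Φ k (z k, z) := fun k =>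
    (hw k).mul ((hΦm k).comp (f := fun z : Particles D N => (z k, z)) (by fun_prop))
  have hr : ∀ k, Measurable fun z : Particles D N =>
      ENNReal.ofReal (A.weight t prev z k) * Ψ (z k) := fun k =>
    (hw k).mul (hΨm.comp (measurable_pi_apply k))
  rw [← lintegral_finsetSum _ fun k _ => hl k, ← lintegral_finsetSum _ fun k _ => hr k]
  refine lintegral_congr fun z => ?_
  have hpos := hA.weight_pos t prev z
  -- Pointwise in `z`, the total weight factors out of the sum over `k`. What remains is averaged
  -- with the normalised weights, as in `ih`.
  simp only [← ofReal_sum_mul_normalize hpos, mul_assoc, ← Finset.mul_sum]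
  rw [ih z _ (isWeight_normalize hpos)]

end Scheme
end ParticlePCNL

namespace ParticlePCNL

variable {D N : ℕ}

namespace Scheme

variable {A : Scheme D N}

/-- The reference particle's ancestor is forced, so `ancestorProb` vanishes off `a k = k'`. -/
lemma ancestorProb_mul_congr {W : Fin (N + 1) → ℝ} {k' k : Fin (N + 1)}
    {a : Fin (N + 1) → Fin (N + 1)} {c d : ENNReal} (h : a k = k' → c = d) :
    ancestorProb W k' k a * c = ancestorProb W k' k a * d := by
  by_cases hak : a k = k'
  · rw [h hak]
  · rw [ancestorProb, Finset.prod_eq_zero (Finset.mem_univ k) (by simp [hak])]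
    simp

/-- Backward sampling reverses the joint law of the index at time `t` and the state at time
`t + 1`. -/
lemma Regular.sum_mul_backward (hA : A.Regular) (t : ℕ) (z : Particles D N)
    {W : Fin (N + 1) → ℝ} (hW : IsWeight W) (x : State D) (l : Fin (N + 1)) :
    (∑ k, ENNReal.ofReal (W k) * ENNReal.ofReal (A.Q t (z k) x)) *
      ENNReal.ofReal (normalize (fun i => W i * A.Q t (z i) x) l) =
    ENNReal.ofReal (W l) * ENNReal.ofReal (A.Q t (z l) x) := by
  have hpos : ∀ i, 0 < W i * A.Q t (z i) x := fun i => mul_pos (hW.pos i) (hA.Q_pos _ _ _)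
  simp only [← ENNReal.ofReal_mul (hW.nonneg _)]
  rw [← ENNReal.ofReal_sum_of_nonneg fun i _ => (hpos i).le]
  exact ofReal_sum_mul_normalize hpos l

/-- Of the path density only the first factor, `Q_t(z k, x 0)`, depends on `k`. Averaged over `k` it
produces the normalising sum of the backward weights, and the product with the backward probability
of `l` collapses to the `l`-th term. -/
lemma Regular.sum_mul_lintegral_backward (hA : A.Regular) (r t : ℕ) (z : Particles D N)
    {W : Fin (N + 1) → ℝ} (hW : IsWeight W) {f : (Fin (r + 2) → State D) → ENNReal}
    (hf : Measurable f) :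
    ∑ k, ENNReal.ofReal (W k) * ∫⁻ x, pathDensity A.Q (r + 1) t (z k) x *
      ∑ l, ENNReal.ofReal (normalize (fun i => W i * A.Q t (z i) (x 0)) l) * f (Fin.cons (z l) x) =
    ∑ k, ENNReal.ofReal (W k) * ∫⁻ x, pathDensity A.Q (r + 1) t (z k) x * f (Fin.cons (z k) x) := by
  have hpd : ∀ k, Measurable fun x => pathDensity A.Q (r + 1) t (z k) x := fun k =>
    (measurable_pathDensity hA.measurable_Q (r + 1) t).comp measurable_prodMk_left
  have hfc : ∀ k, Measurable fun x : Fin (r + 1) → State D =>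
      f (Fin.cons (z k) x : Fin (r + 2) → State D) := fun k =>
    hf.comp (measurable_cons measurable_const measurable_id)
  have hb : ∀ l, Measurable fun x : Fin (r + 1) → State D =>
      ENNReal.ofReal (normalize (fun i => W i * A.Q t (z i) (x 0)) l) := fun l =>
    ENNReal.measurable_ofReal.comp (measurable_normalize (fun i => ((hA.measurable_Q t).comp
      (f := fun x : Fin (r + 1) → State D => (z i, x 0)) (by fun_prop)).const_mul _) l)
  have hl : ∀ k, Measurable fun x : Fin (r + 1) → State D => pathDensity A.Q (r + 1) t (z k) x *
      ∑ l, ENNReal.ofReal (normalize (fun i => W i * A.Q t (z i) (x 0)) l) *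
        f (Fin.cons (z l) x) := fun k =>
    (hpd k).mul (Finset.measurable_fun_sum _ fun l _ => (hb l).mul (hfc l))
  have hr : ∀ k, Measurable fun x : Fin (r + 1) → State D =>
      pathDensity A.Q (r + 1) t (z k) x * f (Fin.cons (z k) x) := fun k => (hpd k).mul (hfc k)
  simp only [← lintegral_const_mul _ (hl _), ← lintegral_const_mul _ (hr _)]
  rw [← lintegral_finsetSum _ fun k _ => (hl k).const_mul _,
    ← lintegral_finsetSum _ fun k _ => (hr k).const_mul _]
  refine lintegral_congr fun x => ?_
  simp only [← mul_assoc, ← Finset.sum_mul, pathDensity]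
  rw [Finset.mul_sum]
  refine Finset.sum_congr rfl fun l _ => ?_
  rw [← hA.sum_mul_backward t z hW (x 0) l]
  ring

/-- Given the particle system at time `t`, the algorithm leaves invariant the law of the index at
time `t` and the states at later times. -/
theorem Regular.sum_lintegral_run (hA : A.Regular) (hN : 1 ≤ N) (r : ℕ) :
    ∀ (t : ℕ) (z : Particles D N) (W : Fin (N + 1) → ℝ), IsWeight W →
      ∀ f : (Fin (r + 1) → State D) → ENNReal, Measurable f →
      ∑ k, ENNReal.ofReal (W k) * ∫⁻ x, pathDensity A.Q r (t + 1) (z k) x *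
        ∫⁻ y, f y ∂A.run r t (k, z, W) x =
      ∑ k, ENNReal.ofReal (W k) *
        ∫⁻ x, pathDensity A.Q r (t + 1) (z k) x * f (Fin.cons (z k) x) := by
  induction r with
  | zero =>
    intro t z W hW f hf
    have hcons : ∀ (k : Fin (N + 1)) (x : Fin 0 → State D),
        (Fin.cons (z k) x : Fin 1 → State D) = fun _ => z k := fun k x => by
      funext i; exact Fin.cases rfl (fun j => j.elim0) i
    have h0 : (volume : Measure (Fin 0 → State D)) Set.univ = 1 := by
      rw [volume_pi, Measure.pi_univ]; simp
    simp only [run, pathDensity, one_mul, hcons, lintegral_map hf (measurable_of_countable _),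
      lintegral_const, h0, mul_one]
    exact hW.sum_mul_lintegral_forcedMove hN fun l => f fun _ => z l
  | succ r ih =>
    intro t z W hW f hf
    -- The right-hand side is rewritten so that both sides apply backward sampling as the last
    -- operation. With `g` denoting `f` averaged over it, the later output need only be compared
    -- with the later reference states when tested against `g`.
    rw [← hA.sum_mul_lintegral_backward r (t + 1) z hW hf]
    set g : (Fin (r + 1) → State D) → ENNReal := fun y =>
      ∑ l, ENNReal.ofReal (normalize (fun i => W i * A.Q (t + 1) (z i) (y 0)) l) *
        f (Fin.cons (z l) y) with hg
    have hgm : Measurable g := by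
      refine Finset.measurable_fun_sum _ fun l _ => Measurable.mul ?_
        (hf.comp (measurable_cons measurable_const measurable_id))
      exact ENNReal.measurable_ofReal.comp (measurable_normalize (fun i =>
        ((hA.measurable_Q (t + 1)).comp (f := fun x : Fin (r + 1) → State D => (z i, x 0))
          (by fun_prop)).const_mul _) l)
    have hpop : ∀ prev : Particles D N, _ := fun prev =>
      hA.sum_lintegral_populate r (t + 1) prev hgm fun z' W' hW' => ih (t + 1) z' W' hW' g hgm
    set B : (Fin (N + 1) → Fin (N + 1)) → Fin (N + 1) → (Fin (r + 1) → State D) → ENNReal :=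
      fun a k x => ∫⁻ s, ∫⁻ y, g y ∂A.run r (t + 1) s (Fin.tail x)
        ∂A.populate (t + 1) (fun n => z (a n)) k (x 0) with hB
    have hBm : ∀ a k, Measurable (B a k) := fun a k => by
      refine IsKernelFun.measurable_lintegral
        (f := fun x : Fin (r + 1) → State D => A.populate (t + 1) (fun n => z (a n)) k (x 0))
        (g := fun p : (Fin (r + 1) → State D) × Slice D N =>
          ∫⁻ y, g y ∂A.run r (t + 1) p.2 (Fin.tail p.1)) ?_ ?_
      · exact (hA.isKernelFun_populate (t + 1) k).comp
          (g := fun x : Fin (r + 1) → State D => ((fun n => z (a n) : Particles D N), x 0))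
          (by fun_prop)
      · exact (hA.measurable_lintegral_run r (t + 1) hgm).comp
          (f := fun p : (Fin (r + 1) → State D) × Slice D N => (p.2, Fin.tail p.1))
          (measurable_snd.prodMk (measurable_tail.comp measurable_fst))
    have hpd : ∀ k, Measurable fun x => pathDensity A.Q (r + 1) (t + 1) (z k) x := fun k =>
      (measurable_pathDensity hA.measurable_Q (r + 1) (t + 1)).comp measurable_prodMk_left
    set u : ENNReal := ENNReal.ofReal (1 / ((N : ℝ) + 1)) with hu
    have hrun : ∀ k' x, ∫⁻ y, f y ∂A.run (r + 1) t (k', z, W) x =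
        ∑ k, u * ∑ a, ancestorProb W k' k a * B a k x := fun k' x => by
      have hm : Measurable fun s' => ∫⁻ y, g y ∂A.run r (t + 1) s' (Fin.tail x) :=
        (hA.measurable_lintegral_run r (t + 1) hgm).comp measurable_prodMk_right
      rw [hA.lintegral_run_succ r t _ x hf]
      exact lintegral_step t _ (x 0) hm
    -- On the support of `ancestorProb` one has `z k' = z (a k)`. This substitution removes `k'`
    -- from the inner integral, leaving it only in `ancestorProb`, where it can be averaged out.
    have hexpand : ∀ k', ∫⁻ x, pathDensity A.Q (r + 1) (t + 1) (z k') x *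
        ∫⁻ y, f y ∂A.run (r + 1) t (k', z, W) x =
        ∑ k, u * ∑ a, ancestorProb W k' k a *
          ∫⁻ x, pathDensity A.Q (r + 1) (t + 1) (z (a k)) x * B a k x := fun k' => by
      have h1 : ∀ k a, ancestorProb W k' k a *
          ∫⁻ x, pathDensity A.Q (r + 1) (t + 1) (z (a k)) x * B a k x =
          ∫⁻ x, ancestorProb W k' k a *
            (pathDensity A.Q (r + 1) (t + 1) (z k') x * B a k x) := fun k a => by
        refine Eq.trans ?_ (lintegral_const_mul _ ((hpd k').mul (hBm a k))).symm
        exact ancestorProb_mul_congr fun h => by rw [h]; rfl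
      have hm1 : ∀ k a, Measurable fun x => ancestorProb W k' k a *
            (pathDensity A.Q (r + 1) (t + 1) (z k') x * B a k x) := fun k a =>
        ((hpd k').mul (hBm a k)).const_mul _
      have hm2 : ∀ k, Measurable fun x => ∑ a, ancestorProb W k' k a *
            (pathDensity A.Q (r + 1) (t + 1) (z k') x * B a k x) := fun k =>
        Finset.measurable_fun_sum _ fun a _ => hm1 k a
      simp only [h1]
      simp only [← lintegral_finsetSum _ fun a _ => hm1 _ a, ← lintegral_const_mul _ (hm2 _)]
      rw [← lintegral_finsetSum _ fun k _ => (hm2 k).const_mul _]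
      refine lintegral_congr fun x => ?_
      rw [hrun, Finset.mul_sum]
      refine Finset.sum_congr rfl fun k _ => ?_
      rw [Finset.mul_sum, Finset.mul_sum, Finset.mul_sum]
      refine Finset.sum_congr rfl fun a _ => ?_
      ring
    simp only [hexpand]
    -- Averaging over `k'` makes the ancestors independent; for each fixed `a`, the identity `hpop`
    -- with parents `z ∘ a` replaces `B` by `g`; finally `a k` alone has law `W`.
    calc _ = ∑ k, u * ∑ k', ENNReal.ofReal (W k') * ∑ a, ancestorProb W k' k a *
          ∫⁻ x, pathDensity A.Q (r + 1) (t + 1) (z (a k)) x * B a k x := by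
          simp only [Finset.mul_sum]
          rw [Finset.sum_comm]
          refine Finset.sum_congr rfl fun k _ => Finset.sum_congr rfl fun k' _ =>
            Finset.sum_congr rfl fun a _ => ?_
          ring
      _ = ∑ k, u * ∑ a : Fin (N + 1) → Fin (N + 1), (∏ n, ENNReal.ofReal (W (a n))) *
          ∫⁻ x, pathDensity A.Q (r + 1) (t + 1) (z (a k)) x * B a k x := by
          simp only [sum_mul_ancestorProb W _ fun a => ∫⁻ x, pathDensity A.Q (r + 1) (t + 1)
            (z (a _)) x * B a _ x]
      _ = u * ∑ a : Fin (N + 1) → Fin (N + 1), (∏ n, ENNReal.ofReal (W (a n))) *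
          ∑ k, ∫⁻ x, pathDensity A.Q (r + 1) (t + 1) (z (a k)) x * B a k x := by
          rw [← Finset.mul_sum, Finset.sum_comm]
          simp only [Finset.mul_sum]
      _ = u * ∑ a : Fin (N + 1) → Fin (N + 1), (∏ n, ENNReal.ofReal (W (a n))) *
          ∑ k, ∫⁻ x, pathDensity A.Q (r + 1) (t + 1) (z (a k)) x * g x := by
          congr 1
          exact Finset.sum_congr rfl fun a _ => congrArg _ (hpop fun n => z (a n))
      _ = ∑ k, u * ∑ a : Fin (N + 1) → Fin (N + 1), (∏ n, ENNReal.ofReal (W (a n))) *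
          ∫⁻ x, pathDensity A.Q (r + 1) (t + 1) (z (a k)) x * g x := by
          rw [← Finset.mul_sum, Finset.sum_comm]
          simp only [Finset.mul_sum]
      _ = ∑ k : Fin (N + 1), u * ∑ k', ENNReal.ofReal (W k') *
          ∫⁻ x, pathDensity A.Q (r + 1) (t + 1) (z k') x * g x := by
          refine Finset.sum_congr rfl fun k _ => ?_
          rw [sum_prod_mul_apply hW.nonneg hW.sum_eq_one k fun k' =>
            ∫⁻ x, pathDensity A.Q (r + 1) (t + 1) (z k') x * g x]
      _ = _ := by rw [← Finset.sum_mul, sum_uniform, one_mul]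

/-- At time one all parents are the dummy state `0`, so the right-hand side of the sum over `k`
consists of `N + 1` equal terms, which the uniform probability of the index compensates. -/
theorem Regular.lintegral_law_eq (hA : A.Regular) (hN : 1 ≤ N) (S : ℕ)
    {f : (Fin (S + 1) → State D) → ENNReal} (hf : Measurable f) :
    ∫⁻ x, pathDensity A.Q (S + 1) 1 0 x * ∫⁻ y, f y ∂A.law S x =
      ∫⁻ x, pathDensity A.Q (S + 1) 1 0 x * f x := by
  have hpop := hA.sum_lintegral_populate S 1 (fun _ => 0) hf fun z W hW =>
    hA.sum_lintegral_run hN S 1 z W hW f hf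
  have hpd : Measurable fun x => pathDensity A.Q (S + 1) 1 0 x :=
    (measurable_pathDensity hA.measurable_Q (S + 1) 1).comp measurable_prodMk_left
  have hB : ∀ k, Measurable fun x : Fin (S + 1) → State D =>
      ∫⁻ s, ∫⁻ y, f y ∂A.run S 1 s (Fin.tail x) ∂A.populate 1 (fun _ => 0) k (x 0) := fun k =>
    IsKernelFun.measurable_lintegral
      (f := fun x : Fin (S + 1) → State D => A.populate 1 (fun _ => 0) k (x 0))
      (g := fun p : (Fin (S + 1) → State D) × Slice D N =>
        ∫⁻ y, f y ∂A.run S 1 p.2 (Fin.tail p.1))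
      ((hA.isKernelFun_populate 1 k).comp
        (g := fun x : Fin (S + 1) → State D => ((fun _ => 0 : Particles D N), x 0)) (by fun_prop))
      ((hA.measurable_lintegral_run S 1 hf).comp
        (f := fun p : (Fin (S + 1) → State D) × Slice D N => (p.2, Fin.tail p.1))
        (measurable_snd.prodMk (measurable_tail.comp measurable_fst)))
  have hm : ∀ k, Measurable fun x : Fin (S + 1) → State D => pathDensity A.Q (S + 1) 1 0 x *
      ∫⁻ s, ∫⁻ y, f y ∂A.run S 1 s (Fin.tail x) ∂A.populate 1 (fun _ => 0) k (x 0) := fun k =>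
    hpd.mul (hB k)
  calc _ = ∫⁻ x, ∑ k, ENNReal.ofReal (1 / ((N : ℝ) + 1)) * (pathDensity A.Q (S + 1) 1 0 x *
        ∫⁻ s, ∫⁻ y, f y ∂A.run S 1 s (Fin.tail x) ∂A.populate 1 (fun _ => 0) k (x 0)) := by
        refine lintegral_congr fun x => ?_
        rw [hA.lintegral_law S x hf, Finset.mul_sum]
        exact Finset.sum_congr rfl fun k _ => mul_left_comm _ _ _
    _ = ENNReal.ofReal (1 / ((N : ℝ) + 1)) * ∑ k, ∫⁻ x, pathDensity A.Q (S + 1) 1 0 x *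
        ∫⁻ s, ∫⁻ y, f y ∂A.run S 1 s (Fin.tail x) ∂A.populate 1 (fun _ => 0) k (x 0) := by
        rw [lintegral_finsetSum _ fun k _ => (hm k).const_mul _, Finset.mul_sum]
        exact Finset.sum_congr rfl fun k _ => lintegral_const_mul _ (hm k)
    _ = ENNReal.ofReal (1 / ((N : ℝ) + 1)) * ∑ _k : Fin (N + 1),
        ∫⁻ x, pathDensity A.Q (S + 1) 1 0 x * f x := by rw [hpop]
    _ = _ := by rw [Finset.mul_sum, ← Finset.sum_mul, sum_uniform, one_mul]

end Scheme
end ParticlePCNL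

namespace ParticlePCNL

variable {D : ℕ}

/-! ### Measurability of the drift -/

lemma measurable_euclidean {X : Type*} [MeasurableSpace X] {f : X → State D}
    (hf : ∀ i, Measurable fun a => f a i) : Measurable f :=
  (MeasurableEquiv.toLp 2 (Fin D → ℝ)).measurable.comp (measurable_pi_lambda _ hf)

/-- Each partial derivative is the pointwise limit of the difference quotients with step `1 / n`,
which are jointly measurable; continuity of the derivative is not required. -/
lemma measurable_gradient_with_param {X : Type*} [MeasurableSpace X] {f : X → State D → ℝ}
    (hf : Measurable fun p : X × State D => f p.1 p.2) (hd : ∀ a, Differentiable ℝ (f a)) :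
    Measurable fun p : X × State D => gradient (f p.1) p.2 := by
  refine measurable_euclidean fun i => ?_
  have hc : Filter.Tendsto (fun n : ℕ => ‖(n : ℝ)‖) Filter.atTop Filter.atTop := by
    simpa using tendsto_natCast_atTop_atTop (R := ℝ)
  refine measurable_of_tendsto_metrizable
    (f := fun (n : ℕ) (p : X × State D) => (n : ℝ) •
      (f p.1 (p.2 + (n : ℝ)⁻¹ • EuclideanSpace.single i (1 : ℝ)) - f p.1 p.2)) (fun n => ?_)
    (tendsto_pi_nhds.2 fun p => ?_)
  · have h : Measurable fun p : X × State D =>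
        f p.1 (p.2 + (n : ℝ)⁻¹ • EuclideanSpace.single i (1 : ℝ)) :=
      hf.comp (f := fun p : X × State D =>
        (p.1, p.2 + (n : ℝ)⁻¹ • EuclideanSpace.single i (1 : ℝ))) (by fun_prop)
    exact (h.sub hf).const_smul (n : ℝ)
  · have h := ((hd p.1) p.2).hasFDerivAt.lim (EuclideanSpace.single i (1 : ℝ)) hc
    have hg : gradient (f p.1) p.2 i =
        fderiv ℝ (f p.1) p.2 (EuclideanSpace.single i (1 : ℝ)) := by
      rw [← InnerProductSpace.toDual_symm_apply (𝕜 := ℝ), ← gradient,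
        EuclideanSpace.inner_single_right]
      simp
    rw [hg]
    exact h

/-! ### Regularity of the generic marginal algorithm -/

section GenericMarginal

variable {N : ℕ} {Q : ℕ → State D → State D → ℝ} {phi : ℕ → State D → State D → State D}
  {v : ℕ → State D → State D} {H R E : ℕ → Matrix (Fin D) (Fin D) ℝ}

lemma isProbabilityMeasure_genericMarginal_propose (t : ℕ) (prev : Particles D N)
    (k : Fin (N + 1)) (x : State D) :
    IsProbabilityMeasure ((genericMarginal N Q phi v H R E).propose t prev k x) := by
  rw [genericMarginal_propose]
  exact isProbabilityMeasure_bind (measurable_refresh_shift ..).aemeasurable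
    (Filter.Eventually.of_forall fun u => inferInstance)

lemma measurable_genericMarginal_propose (t : ℕ) (k : Fin (N + 1))
    (hphi : Measurable fun p : State D × State D => phi t p.1 p.2) (hv : Measurable (v t)) :
    Measurable fun p : Particles D N × State D =>
      (genericMarginal N Q phi v H R E).propose t p.1 k p.2 := by
  have hlin := measurable_toEuclideanLin (H t)
  have hshift : Measurable fun p : Particles D N × State D => p.2 + phi t (p.1 k) p.2 :=
    measurable_snd.add (hphi.comp (f := fun p : Particles D N × State D => (p.1 k, p.2))
      (by fun_prop))
  have hrefresh : Measurable fun q : (Particles D N × State D) × State D =>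
      refresh (R t) k q.1.2 fun n => v t (q.1.1 n) + Matrix.toEuclideanLin (H t) q.2 :=
    measurable_refresh _ _ (by fun_prop) (measurable_pi_lambda _ fun n =>
      (hv.comp (by fun_prop)).add (hlin.comp measurable_snd))
  simp only [genericMarginal_propose]
  exact ((IsKernelFun.of_isProbabilityMeasure (measurable_multivariateGaussian (E t) hshift)
    fun p => inferInstance).bind (IsKernelFun.of_isProbabilityMeasure hrefresh
    fun q => inferInstance)).measurable

end GenericMarginal

namespace Model

variable {F : Model D} {N : ℕ} {δ : ℕ → ℝ} {κ : ℝ} {Cpre : ℕ → State D → Matrix (Fin D) (Fin D) ℝ}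

lemma measurable_drift (hG_pos : ∀ t x' x, 0 < F.G t x' x)
    (hG_meas : ∀ t, Measurable fun p : State D × State D => F.G t p.1 p.2)
    (hG_diff : ∀ t x', Differentiable ℝ (F.G t x'))
    (hCpre : ∀ t i j, Measurable fun x' => Cpre t x' i j) (t : ℕ) :
    Measurable fun p : State D × State D => F.drift δ κ Cpre t p.1 p.2 := by
  have hgrad : Measurable fun p : State D × State D =>
      gradient (fun y => Real.log (F.G t p.1 y)) p.2 :=
    measurable_gradient_with_param (f := fun x' y => Real.log (F.G t x' y))
      (Real.measurable_log.comp (hG_meas t))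
      fun a => (hG_diff t a).log fun x => (hG_pos t a x).ne'
  suffices h : Measurable fun p : State D × State D => Matrix.toEuclideanLin (Cpre t p.1)
      (gradient (fun y => Real.log (F.G t p.1 y)) p.2) from h.const_smul (κ * (δ t / 2))
  refine measurable_euclidean fun i => ?_
  simp only [Matrix.toLpLin_apply, Matrix.mulVec, dotProduct]
  refine Finset.measurable_fun_sum _ fun j _ => Measurable.mul ?_ ?_
  · exact (hCpre t i j).comp measurable_fst
  · fun_prop

lemma measurable_Q (hm : ∀ t, Measurable (F.m t))
    (hG_meas : ∀ t, Measurable fun p : State D × State D => F.G t p.1 p.2) (t : ℕ) :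
    Measurable fun p : State D × State D => F.Q t p.1 p.2 := by
  have := hm t
  have := hG_meas t
  unfold Q M
  fun_prop

lemma Q_pos (hC : ∀ t, (F.C t).PosDef) (hG_pos : ∀ t x' x, 0 < F.G t x' x) (t : ℕ)
    (x' x : State D) : 0 < F.Q t x' x :=
  mul_pos (gaussianDensity_pos _ (hC t) x) (hG_pos t x' x)

theorem regular_genericMarginal
    (hm : ∀ t, Measurable (F.m t)) (hC : ∀ t, (F.C t).PosDef)
    (hG_pos : ∀ t x' x, 0 < F.G t x' x)
    (hG_meas : ∀ t, Measurable fun p : State D × State D => F.G t p.1 p.2)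
    (hG_diff : ∀ t x', Differentiable ℝ (F.G t x')) (hδ : ∀ t, 0 < δ t)
    (hCpre : ∀ t i j, Measurable fun x' => Cpre t x' i j) :
    (genericMarginal N F.Q (F.drift δ κ Cpre) (F.offset δ)
      (fun t => beta (δ t) • (1 : Matrix (Fin D) (Fin D) ℝ))
      (fun t => (1 - beta (δ t)) • F.C t) (fun t => (δ t / 2) • F.C t)).Regular := by
  have hdrift := measurable_drift (δ := δ) (κ := κ) hG_pos hG_meas hG_diff hCpre
  have hoffset : ∀ t, Measurable (F.offset δ t) := fun t =>
    (hm t).const_smul (1 - beta (δ t))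
  have hweight : ∀ t n, Measurable fun p : Particles D N × Particles D N =>
      (genericMarginal N F.Q (F.drift δ κ Cpre) (F.offset δ)
      (fun t => beta (δ t) • (1 : Matrix (Fin D) (Fin D) ℝ))
      (fun t => (1 - beta (δ t)) • F.C t) (fun t => (δ t / 2) • F.C t)).weight t p.1 p.2 n := by
    intro t n
    -- The closed form of the marginal density makes the weight an explicit measurable expression in
    -- the particles, their parents and the drift.
    simp only [genericMarginal, marginalProposal_eq t (hC t) (hδ t)]
    have h1 : Measurable fun p : Particles D N × Particles D N => F.Q t (p.1 n) (p.2 n) :=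
      (measurable_Q hm hG_meas t).comp (f := fun p : Particles D N × Particles D N =>
        (p.1 n, p.2 n)) (by fun_prop)
    have h2 : Measurable fun p : Particles D N × Particles D N =>
        F.drift δ κ Cpre t (p.1 n) (p.2 n) :=
      (hdrift t).comp (f := fun p : Particles D N × Particles D N => (p.1 n, p.2 n)) (by fun_prop)
    have h3 := hoffset t
    unfold commonFactor logWeightFactor
    fun_prop
  refine ⟨measurable_Q hm hG_meas, Q_pos hC hG_pos,
    isProbabilityMeasure_genericMarginal_propose,
    fun t k => measurable_genericMarginal_propose t k (hdrift t) (hoffset t),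
    hweight, fun t prev z n => ?_, fun t prev k f hf => ?_⟩
  · simp only [genericMarginal, marginalProposal_eq t (hC t) (hδ t)]
    exact mul_pos (Q_pos hC hG_pos _ _ _)
      (mul_pos (commonFactor_pos t (hC t) (hδ t) _ _) (Real.exp_pos _))
  · have hint := fun z : Particles D N => integrable_marginalIntegrand t (hC t) (hδ t)
      (fun l => F.drift δ κ Cpre t (prev l) (z l)) (fun l => F.offset δ t (prev l)) z k
    have hw := (hweight t k).comp (f := fun z : Particles D N => (prev, z)) measurable_prodMk_left
    simp only [Function.comp_def] at hw
    exact lintegral_genericMarginal_propose (Q := F.Q) (phi := F.drift δ κ Cpre)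
      (v := F.offset δ) (H := fun t => beta (δ t) • (1 : Matrix (Fin D) (Fin D) ℝ))
      (R := fun t => (1 - beta (δ t)) • F.C t) (E := fun t => (δ t / 2) • F.C t) t prev k
      ((hC t).smul (one_sub_beta_pos (hδ t))) ((hC t).smul (half_pos (hδ t)))
      (fun x => (Q_pos hC hG_pos _ _ _).le) hint hw hf

/-! ### The target distribution -/

lemma unnormalizedTarget_eq (hC : ∀ t, (F.C t).PosDef) (hG_pos : ∀ t x' x, 0 < F.G t x' x)
    (S : ℕ) : F.unnormalizedTarget S = volume.withDensity (pathDensity F.Q (S + 1) 1 0) := by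
  unfold unnormalizedTarget
  congr 1
  funext x
  rw [pathDensity_eq_ofReal_prod fun t x' x => (Q_pos hC hG_pos t x' x).le]
  rfl

/-- The density is strictly positive everywhere, so the total mass is nonzero; with the assumed
finiteness it can be normalised. -/
lemma isProbabilityMeasure_target (hC : ∀ t, (F.C t).PosDef)
    (hG_pos : ∀ t x' x, 0 < F.G t x' x)
    (hQ : ∀ t, Measurable fun p : State D × State D => F.Q t p.1 p.2) (S : ℕ)
    (hπ : F.unnormalizedTarget S Set.univ ≠ ⊤) : IsProbabilityMeasure (F.target S) := by
  have hpd : Measurable (pathDensity F.Q (S + 1) 1 (0 : State D)) :=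
    measurable_pathDensity_right hQ (S + 1) 1 0
  have h0 : F.unnormalizedTarget S Set.univ ≠ 0 := by
    rw [unnormalizedTarget_eq hC hG_pos, withDensity_apply _ MeasurableSet.univ,
      Measure.restrict_univ]
    have hsupp : Function.support (pathDensity F.Q (S + 1) 1 (0 : State D)) = Set.univ := by
      refine Set.eq_univ_of_forall fun x => ?_
      rw [Function.mem_support, pathDensity_eq_ofReal_prod
        fun t x' x => (Q_pos hC hG_pos t x' x).le]
      exact (ENNReal.ofReal_pos.2 (Finset.prod_pos fun i _ => Q_pos hC hG_pos _ _ _)).ne'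
    refine ((lintegral_pos_iff_support hpd).2 ?_).ne'
    rw [hsupp]
    exact isOpen_univ.measure_pos _ Set.univ_nonempty
  constructor
  rw [target, Measure.smul_apply, smul_eq_mul, ENNReal.inv_mul_cancel h0 hπ]

/-- The normalising constant is a common factor, so invariance may be tested on the unnormalised
path density. -/
lemma target_bind_eq (hC : ∀ t, (F.C t).PosDef) (hG_pos : ∀ t x' x, 0 < F.G t x' x)
    (hQ : ∀ t, Measurable fun p : State D × State D => F.Q t p.1 p.2) (S : ℕ)
    {P : (Fin (S + 1) → State D) → Measure (Fin (S + 1) → State D)} (hP : Measurable P)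
    (h : ∀ f : (Fin (S + 1) → State D) → ENNReal, Measurable f →
      ∫⁻ x, pathDensity F.Q (S + 1) 1 0 x * ∫⁻ y, f y ∂P x =
        ∫⁻ x, pathDensity F.Q (S + 1) 1 0 x * f x) :
    (F.target S).bind P = F.target S := by
  have hpd : Measurable (pathDensity F.Q (S + 1) 1 (0 : State D)) :=
    measurable_pathDensity_right hQ (S + 1) 1 0
  refine Measure.ext_of_lintegral _ fun f hf => ?_
  have hPf : Measurable fun x => ∫⁻ y, f y ∂P x := (Measure.measurable_lintegral hf).comp hP
  rw [Measure.lintegral_bind hP.aemeasurable hf.aemeasurable, target, lintegral_smul_measure,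
    lintegral_smul_measure, unnormalizedTarget_eq hC hG_pos,
    lintegral_withDensity_eq_lintegral_mul _ hpd hPf, lintegral_withDensity_eq_lintegral_mul _ hpd hf]
  exact congrArg _ (h f hf)

end Model

end ParticlePCNL

/-! ### Conclusion -/

theorem mainTheorem11 (D N S : ℕ) (hN : 1 ≤ N) (F : ParticlePCNL.Model D)
    (δ : ℕ → ℝ) (κ : ℝ) (Cpre : ℕ → ParticlePCNL.State D → Matrix (Fin D) (Fin D) ℝ)
    (hm : ∀ t, Measurable (F.m t))
    (hC : ∀ t, (F.C t).PosDef)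
    (hG_pos : ∀ t x' x, 0 < F.G t x' x)
    (hG_meas : ∀ t, Measurable fun p : ParticlePCNL.State D × ParticlePCNL.State D =>
      F.G t p.1 p.2)
    (hG_diff : ∀ t x', Differentiable ℝ (F.G t x'))
    (hδ : ∀ t, 0 < δ t)
    (hκ : κ = 0 ∨ κ = 1)
    (hCpre : ∀ t i j, Measurable fun x' => Cpre t x' i j)
    (hπ : F.unnormalizedTarget S Set.univ ≠ ⊤) :
    (∃ P : ProbabilityTheory.Kernel (Fin (S + 1) → ParticlePCNL.State D)
        (Fin (S + 1) → ParticlePCNL.State D),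
      ProbabilityTheory.IsMarkovKernel P ∧
      (∀ x, P x = (F.pcnl N δ κ Cpre).law S x) ∧
      MeasureTheory.IsProbabilityMeasure (F.target S) ∧
      P.Invariant (F.target S)) ∧
    ∀ x, (F.pcnl N δ κ Cpre).law S x =
      (ParticlePCNL.genericMarginal N F.Q (F.drift δ κ Cpre) (F.offset δ)
        (fun t => ParticlePCNL.beta (δ t) • (1 : Matrix (Fin D) (Fin D) ℝ))
        (fun t => (1 - ParticlePCNL.beta (δ t)) • F.C t)
        (fun t => (δ t / 2) • F.C t)).law S x := by
  have hlaw := ParticlePCNL.Model.law_pcnl_eq_law_genericMarginal (N := N) hC hδ κ Cpre S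
  have hA := ParticlePCNL.Model.regular_genericMarginal (N := N) (κ := κ)
    hm hC hG_pos hG_meas hG_diff hδ hCpre
  have hmeas := (hA.isKernelFun_law S).measurable
  have hQ := ParticlePCNL.Model.measurable_Q hm hG_meas
  -- The kernel is built from the generic marginal algorithm, for which regularity was shown; `hlaw`
  -- identifies it with Particle-PCNL.
  refine ⟨⟨⟨_, hmeas⟩, ⟨fun x => hA.isProbabilityMeasure_law hN S x⟩, fun x => (hlaw x).symm,
    ParticlePCNL.Model.isProbabilityMeasure_target hC hG_pos hQ S hπ, ?_⟩, hlaw⟩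
  exact ParticlePCNL.Model.target_bind_eq hC hG_pos hQ S hmeas fun f hf =>
    hA.lintegral_law_eq hN S hf
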